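/- A translation surface is a triple $(S,\Sigma,\omega)$, where $S$ is a compact connected oriented surface without boundary, $\Sigma\subset S$ is a finite (possibly empty) set of singularities, and $\omega$ is an atlas of $S\setminus\Sigma$ with values in $\mathbb R^2=\mathbb C$ whose coordinate changes are locally of the form $z'=z+\mathrm{const}$, such that each $P\in\Sigma$ has a punctured neighbourhood isomorphic, as a translation structure, to a punctured neighbourhood of the cone point of the connected $(k_P+1)$-sheeted covering of $\mathbb R^2\setminus\{0\}$, for some integer $k_P\ge 0$ (so $P$ is a cone point of angle $2(k_P+1)\pi$; $k_P=0$, a marked point, is allowed). For $\theta\in\mathbb S^1$, the directional flow $\mathcal F_\theta$ moves the points of $S\setminus\Sigma$ at unit speed in the direction $\theta$ in the charts, as long as the trajectory does not reach $\Sigma$. The leaf of a point of $S\setminus\Sigma$ is its full orbit, in positive and negative time as far as defined. The flow $\mathcal F_\theta$ is called minimal if every leaf is dense in $S$. A saddle connection in direction $\theta$ is a straight segment of positive length in direction $\theta$ that joins two (possibly equal) points of $\Sigma$ and has no point of $\Sigma$ in its interior. **Theorem (weak KMS).** Let $S$ be a translation surface. For Lebesgue-almost every $\theta\in\mathbb S^1$,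 the directional flow $\mathcal F_\theta$ on $S$ is minimal. More precisely: 1. the set of $\theta\in\mathbb S^1$ for which $\mathcal F_\theta$ is not minimal is at most countable; 2. if $\Sigma\neq\emptyset$ and there is no saddle connection in direction $\theta$, then $\mathcal F_\theta$ is minimal; 3. the set of $\theta\in\mathbb S^1$ for which there is a saddle connection in direction $\theta$ is at most countable. -/

import Mathlib

open MeasureTheory Set Filter Topology

/-- A translation structure on a topological space `S` (which the theorem takes compact, connected
and Hausdorff; together with the charts below this makes `S` a closed surface): a finite set `sing`
of singularities and an atlas of complex charts on its complement whose coordinate changes are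
locally of the form `z' = z + const`. Near each singularity `P` there is a local homeomorphism
`w` onto a neighbourhood of `0` in `ℂ`, with `w P = 0`, that identifies the punctured neighbourhood
of `P` with the connected `(k + 1)`-sheeted covering `w ↦ w ^ (k + 1)` of a punctured neighbourhood
of the origin in the plane: the translation charts have the form `z = w ^ (k + 1) + const` there,
so `P` is a conical point of angle `2 (k + 1) π`. The value `k = 0` (a marked point) is allowed. -/
structure TranslationSurface (S : Type*) [TopologicalSpace S] where
  /-- the set `Σ` of singularities -/
  sing : Set S
  sing_finite : sing.Finite
  /-- the charts of the translation atlas on the complement of `Σ` -/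
  atlas : Set (OpenPartialHomeomorph S ℂ)
  source_subset : ∀ e ∈ atlas, e.source ⊆ singᶜ
  cover : ∀ x ∉ sing, ∃ e ∈ atlas, x ∈ e.source
  transition : ∀ e ∈ atlas, ∀ e' ∈ atlas, ∀ x ∈ e.source ∩ e'.source,
    ∀ᶠ y in 𝓝 x, e' y - e y = e' x - e x
  cone : ∀ P ∈ sing, ∃ (k : ℕ) (w : OpenPartialHomeomorph S ℂ),
    P ∈ w.source ∧ w P = 0 ∧ w.source ∩ sing = {P} ∧
    ∀ e ∈ atlas, ∀ x ∈ e.source ∩ w.source,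
      ∀ᶠ y in 𝓝 x, e y - w y ^ (k + 1) = e x - w x ^ (k + 1)

namespace TranslationSurface

variable {S : Type*} [TopologicalSpace S]

/-- On the interval `J`, the curve `γ` stays in the complement of the singularities and moves
there with constant velocity `θ` (a unit complex number), as seen in the translation charts. -/
def IsTrajectory (M : TranslationSurface S) (θ : Metric.sphere (0 : ℂ) 1) (γ : ℝ → S)
    (J : Set ℝ) : Prop :=
  ContinuousOn γ J ∧ ∀ s ∈ J, γ s ∉ M.sing ∧
    ∀ e ∈ M.atlas, γ s ∈ e.source →
      ∀ᶠ u in 𝓝[J] s, e (γ u) = e (γ s) + ((u - s : ℝ) : ℂ) * (θ : ℂ)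

/-- The directional flow `F_θ`, as a partially defined flow given by its graph: `F_θ^t x` is
defined and equal to `y`. The time `t` may be negative. -/
def Flow (M : TranslationSurface S) (θ : Metric.sphere (0 : ℂ) 1) (t : ℝ) (x y : S) : Prop :=
  ∃ γ : ℝ → S, M.IsTrajectory θ γ (uIcc 0 t) ∧ γ 0 = x ∧ γ t = y

/-- The leaf (full orbit) of `F_θ` through `x`. -/
def leaf (M : TranslationSurface S) (θ : Metric.sphere (0 : ℂ) 1) (x : S) : Set S :=
  {y | ∃ t : ℝ, M.Flow θ t x y}

/-- The flow `F_θ` is minimal: all its leaves are dense in `S`. -/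
def IsMinimal (M : TranslationSurface S) (θ : Metric.sphere (0 : ℂ) 1) : Prop :=
  ∀ x ∉ M.sing, Dense (M.leaf θ x)

/-- There is a saddle connection in direction `θ`: a straight segment of positive length in
direction `θ` joining two (possibly equal) singularities, with no singularity in its interior. -/
def HasSaddleConnection (M : TranslationSurface S) (θ : Metric.sphere (0 : ℂ) 1) : Prop :=
  ∃ (L : ℝ) (γ : ℝ → S), 0 < L ∧ ContinuousOn γ (Icc 0 L) ∧ γ 0 ∈ M.sing ∧ γ L ∈ M.sing ∧
    M.IsTrajectory θ γ (Ioo 0 L)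

end TranslationSurface

namespace TranslationSurface

variable {S : Type*} [TopologicalSpace S]

/-! Let `Σ` be nonempty and let direction `θ` carry no saddle connection. The closure `A` of a leaf
is closed and invariant, because the flow commutes with small translations
(`Flow.eventually_shift`). If `A` is not all of `S`, then connectedness of the punctured surface
gives `A` a regular boundary point. Moving off it along the normal yields a transverse segment that
meets `A` exactly in its origin `y` (`exists_transversal`). Since a point that reaches `Σ` both
forward and backward lies on a saddle connection, `y` flows forever in at least one time direction.

The segment must then return to itself, which contradicts its position relative to `A`
(`false_of_transversal`). If some initial piece of the segment flows forever, compactness makes the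
orbit of its midpoint return near itself; sliding along the segment turns this into a return of the
origin to the segment, or of a segment point to the origin (`exists_return_of_forall_flow`).
Otherwise arbitrarily short pieces contain points that reach `Σ`. Only finitely many separatrices
enter `Σ`, so two such points share a leaf, and the flow between them carries `y` into the segment
(`exists_return_of_exists_hits`). A periodic `y` is excluded by `not_flow_self`: periodicity with a
given period would spread to all of `S ∖ Σ`, including points that run into a singularity.

For countability, the holonomy vectors of saddle connections lie in the countable group generated by
the constants of the coordinate changes, and a nonzero vector determines its direction. When `Σ` is
empty, marking one point reduces to the previous case. -/

open Classical in
/-- The point obtained from `x` by the translation `v`, read in a chart around `x`. It is meaningful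
for `x` outside the singularities and `v` close to `0`. -/
noncomputable def shift (M : TranslationSurface S) (x : S) (v : ℂ) : S :=
  if h : ∃ e ∈ M.atlas, x ∈ e.source then h.choose.symm (h.choose x + v) else x

/-! ### Local translations and trajectories -/

variable {M : TranslationSurface S} {θ : Metric.sphere (0 : ℂ) 1}

lemma exists_shift_eq {x : S} (hx : x ∉ M.sing) :
    ∃ e ∈ M.atlas, x ∈ e.source ∧ ∀ v, M.shift x v = e.symm (e x + v) := by
  have h : ∃ e ∈ M.atlas, x ∈ e.source := M.cover x hx
  refine ⟨h.choose, h.choose_spec.1, h.choose_spec.2, fun v => ?_⟩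
  rw [shift, dif_pos h]

lemma notMem_sing_of_mem_source {e : OpenPartialHomeomorph S ℂ} (he : e ∈ M.atlas) {x : S}
    (hx : x ∈ e.source) : x ∉ M.sing := M.source_subset e he hx

lemma map_add_left_nhds_zero' (z : ℂ) : map (fun v => z + v) (𝓝 0) = 𝓝 z := by
  simp

lemma map_shift_nhds {x : S} (hx : x ∉ M.sing) : map (M.shift x) (𝓝 0) = 𝓝 x := by
  obtain ⟨e, he, hxe, h⟩ := exists_shift_eq hx
  rw [← e.symm_map_nhds_eq hxe, ← map_add_left_nhds_zero' (e x), Filter.map_map]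
  congr 1
  ext v
  exact h v

lemma tendsto_shift {x : S} (hx : x ∉ M.sing) : Tendsto (M.shift x) (𝓝 0) (𝓝 x) :=
  (map_shift_nhds hx).le

lemma eventually_nhds_iff_shift {x : S} (hx : x ∉ M.sing) {p : S → Prop} :
    (∀ᶠ y in 𝓝 x, p y) ↔ ∀ᶠ v in 𝓝 0, p (M.shift x v) := by
  rw [← map_shift_nhds hx, eventually_map]

lemma frequently_nhds_iff_shift {x : S} (hx : x ∉ M.sing) {p : S → Prop} :
    (∃ᶠ y in 𝓝 x, p y) ↔ ∃ᶠ v in 𝓝 0, p (M.shift x v) := by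
  rw [← map_shift_nhds hx, frequently_map]

lemma shift_zero {x : S} (hx : x ∉ M.sing) : M.shift x 0 = x := by
  obtain ⟨e, he, hxe, h⟩ := exists_shift_eq hx
  rw [h, add_zero, e.left_inv hxe]

lemma eventually_nhds_notMem_sing {x : S} (hx : x ∉ M.sing) : ∀ᶠ y in 𝓝 x, y ∉ M.sing := by
  obtain ⟨e, he, hxe⟩ := M.cover x hx
  filter_upwards [e.open_source.mem_nhds hxe] with y hy using notMem_sing_of_mem_source he hy

lemma isOpen_compl_sing (M : TranslationSurface S) : IsOpen M.singᶜ :=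
  isOpen_iff_mem_nhds.2 fun _ hx => eventually_nhds_notMem_sing hx

/-- A local coordinate whose difference with the charts of the atlas is locally constant moves by
`v` under a small translation by `v`. -/
lemma eventually_coord_shift {x : S} (hx : x ∉ M.sing) {f : S → ℂ}
    (hf : ∀ e ∈ M.atlas, x ∈ e.source → ∀ᶠ y in 𝓝 x, e y - f y = e x - f x) :
    ∀ᶠ v in 𝓝 0, f (M.shift x v) = f x + v := by
  obtain ⟨e, he, hxe, h⟩ := exists_shift_eq hx
  have h1 := (eventually_nhds_iff_shift hx).1 (hf e he hxe)
  have h2 : ∀ᶠ v in 𝓝 (0 : ℂ), e x + v ∈ e.target := by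
    have : Tendsto (fun v => e x + v) (𝓝 0) (𝓝 (e x)) := (map_add_left_nhds_zero' _).le
    exact this (e.open_target.mem_nhds (e.map_source hxe))
  filter_upwards [h1, h2] with v h1 h2
  have h3 : e (M.shift x v) = e x + v := by rw [h, e.right_inv h2]
  rw [h3] at h1
  linear_combination -h1

lemma eventually_chart_shift {e : OpenPartialHomeomorph S ℂ} (he : e ∈ M.atlas) {x : S}
    (hx : x ∈ e.source) :
    ∀ᶠ v in 𝓝 0, M.shift x v ∈ e.source ∧ e (M.shift x v) = e x + v := by
  have hx' := notMem_sing_of_mem_source he hx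
  have h1 := (eventually_nhds_iff_shift hx').1 (e.open_source.mem_nhds hx)
  filter_upwards [h1, eventually_coord_shift hx' (f := e)
    fun e' he' hxe' => M.transition e he e' he' x ⟨hx, hxe'⟩] with v h1 h2 using ⟨h1, h2⟩

lemma eventually_shift_eq {e : OpenPartialHomeomorph S ℂ} (he : e ∈ M.atlas) {x : S}
    (hx : x ∈ e.source) : ∀ᶠ v in 𝓝 0, M.shift x v = e.symm (e x + v) := by
  filter_upwards [eventually_chart_shift he hx] with v hv
  rw [← hv.2, e.left_inv hv.1]

/-- Around a regular point the translations form a local group. -/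
lemma exists_ball_shift_shift {x : S} (hx : x ∉ M.sing) :
    ∃ r > 0, ∀ v : ℂ, ‖v‖ < r → M.shift x v ∉ M.sing ∧
      ∀ᶠ u in 𝓝 0, M.shift (M.shift x v) u = M.shift x (v + u) := by
  obtain ⟨e, he, hxe, h⟩ := exists_shift_eq hx
  obtain ⟨r, hr, hball⟩ := Metric.isOpen_iff.1 e.open_target _ (e.map_source hxe)
  refine ⟨r, hr, fun v hv => ?_⟩
  have hv' : e x + v ∈ e.target := hball (by simpa using hv)
  have h1 : M.shift x v ∈ e.source := by rw [h]; exact e.map_target hv'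
  have h2 : e (M.shift x v) = e x + v := by rw [h, e.right_inv hv']
  refine ⟨notMem_sing_of_mem_source he h1, ?_⟩
  filter_upwards [eventually_shift_eq he h1] with u hu
  rw [hu, h2, h, add_assoc]

lemma tendsto_sub_mul (s : ℝ) (z : ℂ) (J : Set ℝ) :
    Tendsto (fun u : ℝ => ((u - s : ℝ) : ℂ) * z) (𝓝[J] s) (𝓝 0) := by
  have : Continuous fun u : ℝ => ((u - s : ℝ) : ℂ) * z := by fun_prop
  simpa using (this.tendsto s).mono_left nhdsWithin_le_nhds

/-- Trajectories are the curves that move by small translations. -/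
lemma isTrajectory_iff {γ : ℝ → S} {J : Set ℝ} :
    M.IsTrajectory θ γ J ↔ ∀ s ∈ J, γ s ∉ M.sing ∧
      ∀ᶠ u in 𝓝[J] s, γ u = M.shift (γ s) (((u - s : ℝ) : ℂ) * θ) := by
  constructor
  · rintro ⟨hc, h⟩ s hs
    obtain ⟨hsing, h⟩ := h s hs
    refine ⟨hsing, ?_⟩
    obtain ⟨e, he, hse, hshift⟩ := exists_shift_eq hsing
    filter_upwards [h e he hse, (hc s hs) (e.open_source.mem_nhds hse)] with u hu hu'
    rw [hshift, ← hu, e.left_inv hu']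
  · intro h
    refine ⟨fun s hs => ?_, fun s hs => ⟨(h s hs).1, fun e he hse => ?_⟩⟩
    · have h1 := (tendsto_shift (h s hs).1).comp (tendsto_sub_mul s (θ : ℂ) J)
      exact h1.congr' ((h s hs).2.mono fun u hu => hu.symm)
    · have h1 := (tendsto_sub_mul s (θ : ℂ) J).eventually (eventually_chart_shift he hse)
      filter_upwards [h1, (h s hs).2] with u h1 h2
      rw [h2, h1.2]

lemma IsTrajectory.mono {γ : ℝ → S} {J J' : Set ℝ} (h : M.IsTrajectory θ γ J) (hJ : J' ⊆ J) :
    M.IsTrajectory θ γ J' := by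
  rw [isTrajectory_iff] at h ⊢
  exact fun s hs => ⟨(h s (hJ hs)).1, (h s (hJ hs)).2.filter_mono (nhdsWithin_mono _ hJ)⟩

lemma IsTrajectory.congr {γ γ' : ℝ → S} {J : Set ℝ} (h : M.IsTrajectory θ γ J)
    (hJ : EqOn γ' γ J) : M.IsTrajectory θ γ' J := by
  rw [isTrajectory_iff] at h ⊢
  intro s hs
  rw [hJ hs]
  refine ⟨(h s hs).1, ?_⟩
  filter_upwards [(h s hs).2, self_mem_nhdsWithin] with u hu hu'
  rw [hJ hu', hu]

lemma IsTrajectory.comp_add {γ : ℝ → S} {J : Set ℝ} (h : M.IsTrajectory θ γ J) (c : ℝ) :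
    M.IsTrajectory θ (fun t => γ (t + c)) ((fun t => t + c) ⁻¹' J) := by
  rw [isTrajectory_iff] at h ⊢
  intro s hs
  refine ⟨(h _ hs).1, ?_⟩
  have h1 : Tendsto (fun t : ℝ => t + c) (𝓝[(fun t => t + c) ⁻¹' J] s) (𝓝[J] (s + c)) :=
    tendsto_nhdsWithin_of_tendsto_nhds_of_eventually_within _
      (((continuous_add_const c).tendsto s).mono_left nhdsWithin_le_nhds)
      self_mem_nhdsWithin
  filter_upwards [h1.eventually (h _ hs).2] with u hu
  rw [hu]
  congr 3
  ring

lemma IsTrajectory.comp_neg {γ : ℝ → S} {J : Set ℝ} (h : M.IsTrajectory θ γ J) :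
    M.IsTrajectory (-θ) (fun t => γ (-t)) (Neg.neg ⁻¹' J) := by
  rw [isTrajectory_iff] at h ⊢
  intro s hs
  refine ⟨(h _ hs).1, ?_⟩
  have h1 : Tendsto (fun t : ℝ => -t) (𝓝[Neg.neg ⁻¹' J] s) (𝓝[J] (-s)) :=
    tendsto_nhdsWithin_of_tendsto_nhds_of_eventually_within _
      ((continuous_neg.tendsto s).mono_left nhdsWithin_le_nhds) self_mem_nhdsWithin
  filter_upwards [h1.eventually (h _ hs).2] with u hu
  rw [hu]
  congr 1
  rw [show ((-θ : Metric.sphere (0 : ℂ) 1) : ℂ) = -(θ : ℂ) from rfl]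
  push_cast
  ring

lemma IsTrajectory.union {γ₁ γ₂ : ℝ → S} {J₁ J₂ : Set ℝ} [∀ u, Decidable (u ∈ J₁)]
    (h₁ : M.IsTrajectory θ γ₁ J₁) (h₂ : M.IsTrajectory θ γ₂ J₂) (hc₁ : IsClosed J₁)
    (hc₂ : IsClosed J₂) (heq : EqOn γ₁ γ₂ (J₁ ∩ J₂)) :
    M.IsTrajectory θ (fun u => if u ∈ J₁ then γ₁ u else γ₂ u) (J₁ ∪ J₂) := by
  set γ : ℝ → S := fun u => if u ∈ J₁ then γ₁ u else γ₂ u with hγ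
  have e₁ : EqOn γ γ₁ J₁ := fun u hu => if_pos hu
  have e₂ : EqOn γ γ₂ J₂ := fun u hu => by
    by_cases h : u ∈ J₁
    · rw [e₁ h, heq ⟨h, hu⟩]
    · exact if_neg h
  have h₁' := isTrajectory_iff.1 (h₁.congr e₁)
  have h₂' := isTrajectory_iff.1 (h₂.congr e₂)
  rw [isTrajectory_iff]
  intro s hs
  refine ⟨hs.elim (fun h => (h₁' s h).1) (fun h => (h₂' s h).1), ?_⟩
  rw [nhdsWithin_union, eventually_sup]
  constructor
  · by_cases h : s ∈ J₁
    · exact (h₁' s h).2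
    · rw [notMem_closure_iff_nhdsWithin_eq_bot.1 (by rwa [hc₁.closure_eq])]
      exact eventually_bot
  · by_cases h : s ∈ J₂
    · exact (h₂' s h).2
    · rw [notMem_closure_iff_nhdsWithin_eq_bot.1 (by rwa [hc₂.closure_eq])]
      exact eventually_bot

/-- Agreement at a time spreads to nearby times by the local formula, disagreement by the Hausdorff
property; on a preconnected set of times one of the two prevails. -/
lemma IsTrajectory.eqOn [T2Space S] {γ₁ γ₂ : ℝ → S} {J : Set ℝ} (h₁ : M.IsTrajectory θ γ₁ J)
    (h₂ : M.IsTrajectory θ γ₂ J) (hJ : IsPreconnected J) {s : ℝ} (hs : s ∈ J)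
    (heq : γ₁ s = γ₂ s) : EqOn γ₁ γ₂ J := by
  intro u hu
  refine (hJ.induction₂ (fun a b => γ₁ a = γ₂ a ↔ γ₁ b = γ₂ b) (fun a ha => ?_)
    (fun _ _ _ _ _ _ => Iff.trans) (fun _ _ _ _ => Iff.symm) hs hu).1 heq
  by_cases h : γ₁ a = γ₂ a
  · filter_upwards [(isTrajectory_iff.1 h₁ a ha).2, (isTrajectory_iff.1 h₂ a ha).2] with b h1 h2
    simp only [h, true_iff]
    rw [h1, h2, h]
  · have hne := ((h₁.1 a ha).prodMk_nhds (h₂.1 a ha)).eventually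
      (isClosed_diagonal.isOpen_compl.mem_nhds (x := (γ₁ a, γ₂ a)) h)
    exact hne.mono fun b hb => iff_of_false h hb

/-! ### The partial flow -/

lemma Flow.notMem_left {t : ℝ} {x y : S} (h : M.Flow θ t x y) : x ∉ M.sing := by
  obtain ⟨γ, h, rfl, rfl⟩ := h
  exact (h.2 0 left_mem_uIcc).1

lemma Flow.notMem_right {t : ℝ} {x y : S} (h : M.Flow θ t x y) : y ∉ M.sing := by
  obtain ⟨γ, h, rfl, rfl⟩ := h
  exact (h.2 t right_mem_uIcc).1

lemma IsTrajectory.flow {γ : ℝ → S} {J : Set ℝ} (h : M.IsTrajectory θ γ J) {a b : ℝ}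
    (hab : uIcc a b ⊆ J) : M.Flow θ (b - a) (γ a) (γ b) := by
  refine ⟨fun t => γ (t + a), (h.comp_add a).mono fun t ht => hab ?_, by simp, by simp⟩
  rcases le_total a b with h | h
  · rw [uIcc_of_le (by linarith)] at ht
    rw [uIcc_of_le h]
    exact ⟨by linarith [ht.1], by linarith [ht.2]⟩
  · rw [uIcc_of_ge (by linarith)] at ht
    rw [uIcc_of_ge h]
    exact ⟨by linarith [ht.1], by linarith [ht.2]⟩

lemma flow_zero {x : S} (hx : x ∉ M.sing) : M.Flow θ 0 x x := by
  refine ⟨fun _ => x, isTrajectory_iff.2 ?_, rfl, rfl⟩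
  intro s hs
  refine ⟨hx, ?_⟩
  filter_upwards [self_mem_nhdsWithin] with u hu
  simp only [uIcc_self, mem_singleton_iff] at hs hu
  simp [hs, hu, shift_zero hx]

lemma Flow.symm {t : ℝ} {x y : S} (h : M.Flow θ t x y) : M.Flow θ (-t) y x := by
  obtain ⟨γ, h, rfl, rfl⟩ := h
  simpa using h.flow (a := t) (b := 0) (by rw [uIcc_comm])

lemma Flow.exists_trajectory {t : ℝ} {x y : S} (h : M.Flow θ t x y) :
    ∃ γ : ℝ → S, M.IsTrajectory θ γ (uIcc 0 t) ∧ γ 0 = x ∧ γ t = y ∧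
      ∀ a ∈ uIcc 0 t, ∀ b ∈ uIcc 0 t, M.Flow θ (b - a) (γ a) (γ b) := by
  obtain ⟨γ, h, h0, h1⟩ := h
  exact ⟨γ, h, h0, h1, fun a ha b hb => h.flow (uIcc_subset_uIcc ha hb)⟩

lemma Flow.exists_between {t u : ℝ} {x y : S} (h : M.Flow θ t x y) (hu : u ∈ uIcc 0 t) :
    ∃ z, M.Flow θ u x z ∧ M.Flow θ (t - u) z y := by
  obtain ⟨γ, h, rfl, rfl, h'⟩ := h.exists_trajectory
  exact ⟨γ u, by simpa using h' 0 left_mem_uIcc u hu, h' u hu t right_mem_uIcc⟩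

lemma flow_neg_iff {t : ℝ} {x y : S} : M.Flow (-θ) t x y ↔ M.Flow θ (-t) x y := by
  have key : ∀ (θ : Metric.sphere (0 : ℂ) 1) (t : ℝ), M.Flow θ t x y → M.Flow (-θ) (-t) x y := by
    rintro θ t ⟨γ, h, rfl, rfl⟩
    refine ⟨fun u => γ (-u), h.comp_neg.mono fun u hu => ?_, by simp, by simp⟩
    rcases le_total 0 t with h | h
    · rw [uIcc_of_ge (by linarith)] at hu
      simp only [mem_preimage, uIcc_of_le h]
      exact ⟨by linarith [hu.2], by linarith [hu.1]⟩
    · rw [uIcc_of_le (by linarith)] at hu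
      simp only [mem_preimage, uIcc_of_ge h]
      exact ⟨by linarith [hu.2], by linarith [hu.1]⟩
  exact ⟨fun h => by simpa using key _ _ h, fun h => by simpa using key _ _ h⟩

lemma Flow.unique [T2Space S] {t : ℝ} {x y y' : S} (h : M.Flow θ t x y) (h' : M.Flow θ t x y') :
    y = y' := by
  obtain ⟨γ, h, h0, rfl⟩ := h
  obtain ⟨γ', h', h0', rfl⟩ := h'
  exact h.eqOn h' isPreconnected_uIcc left_mem_uIcc (h0.trans h0'.symm) right_mem_uIcc

lemma Flow.unique_left [T2Space S] {t : ℝ} {x x' y : S} (h : M.Flow θ t x y)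
    (h' : M.Flow θ t x' y) : x = x' := h.symm.unique h'.symm

open Classical in
lemma Flow.add [T2Space S] {s t : ℝ} {x y z : S} (h : M.Flow θ s x y) (h' : M.Flow θ t y z) :
    M.Flow θ (s + t) x z := by
  obtain ⟨γ₁, h₁, rfl, rfl⟩ := h
  obtain ⟨γ₂, h₂, h0, rfl⟩ := h'
  set γ₃ : ℝ → S := fun u => γ₂ (u + -s) with hγ₃
  have h₃ : M.IsTrajectory θ γ₃ (uIcc s (s + t)) := (h₂.comp_add (-s)).mono fun u hu => by
    rcases le_total 0 t with h | h
    · rw [uIcc_of_le (by linarith)] at hu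
      simp only [mem_preimage, uIcc_of_le h]
      exact ⟨by linarith [hu.1], by linarith [hu.2]⟩
    · rw [uIcc_of_ge (by linarith)] at hu
      simp only [mem_preimage, uIcc_of_ge h]
      exact ⟨by linarith [hu.1], by linarith [hu.2]⟩
  have h3s : γ₃ s = γ₁ s := by simp [hγ₃, h0]
  -- When `s` and `t` have opposite signs the two time intervals overlap in more than a point;
  -- uniqueness of trajectories makes the pieces agree there.
  have heq : EqOn γ₁ γ₃ (uIcc 0 s ∩ uIcc s (s + t)) :=
    (h₁.mono inter_subset_left).eqOn (h₃.mono inter_subset_right)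
      (ordConnected_uIcc.inter ordConnected_uIcc).isPreconnected
      ⟨right_mem_uIcc, left_mem_uIcc⟩ h3s.symm
  have hU := h₁.union h₃ isClosed_Icc isClosed_Icc heq
  have := hU.flow (a := 0) (b := s + t) uIcc_subset_uIcc_union_uIcc
  simp only [left_mem_uIcc, if_true, sub_zero] at this
  convert this using 1
  split_ifs with hs
  · rw [heq ⟨hs, right_mem_uIcc⟩]; simp [hγ₃]
  · simp [hγ₃]

lemma exists_ball_flow_shift {x : S} (hx : x ∉ M.sing) :
    ∃ r > 0, ∀ v : ℂ, ‖v‖ < r → M.shift x v ∉ M.sing ∧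
      (∀ᶠ u in 𝓝 0, M.shift (M.shift x v) u = M.shift x (v + u)) ∧
      ∀ (θ : Metric.sphere (0 : ℂ) 1) (t : ℝ), ‖v + t * (θ : ℂ)‖ < r →
        M.Flow θ t (M.shift x v) (M.shift x (v + t * (θ : ℂ))) := by
  obtain ⟨r, hr, h⟩ := exists_ball_shift_shift hx
  refine ⟨r, hr, fun v hv => ⟨(h v hv).1, (h v hv).2, fun θ t ht => ?_⟩⟩
  refine ⟨fun u => M.shift x (v + u * (θ : ℂ)), isTrajectory_iff.2 fun s hs => ?_, by simp, by simp⟩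
  have hseg : ‖v + s * (θ : ℂ)‖ < r := by
    have hconv := convex_ball (0 : ℂ) r
    have hpre : Convex ℝ {s : ℝ | v + s * (θ : ℂ) ∈ Metric.ball (0 : ℂ) r} := by
      intro a ha b hb p q hp hq hpq
      have := hconv ha hb hp hq hpq
      have hpq' : (p : ℂ) + q = 1 := by exact_mod_cast hpq
      have he : v + ((p • a + q • b : ℝ) : ℂ) * (θ : ℂ)
          = p • (v + a * (θ : ℂ)) + q • (v + b * (θ : ℂ)) := by
        simp only [smul_eq_mul, Complex.real_smul]
        push_cast
        linear_combination (-v) * hpq'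
      change _ ∈ Metric.ball _ _
      rw [he]
      exact this
    have := hpre.ordConnected.uIcc_subset (x := 0) (y := t) (by simpa using hv) (by simpa using ht) hs
    simpa using this
  refine ⟨(h _ hseg).1, ?_⟩
  filter_upwards [(tendsto_sub_mul s (θ : ℂ) (uIcc 0 t)).eventually (h _ hseg).2] with u hu
  rw [hu]
  congr 1
  push_cast
  ring

lemma exists_flow_shift {x : S} (hx : x ∉ M.sing) : ∃ r > 0,
    ∀ (θ : Metric.sphere (0 : ℂ) 1) (t : ℝ), |t| < r → M.Flow θ t x (M.shift x (t * (θ : ℂ))) := by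
  obtain ⟨r, hr, h⟩ := exists_ball_flow_shift hx
  refine ⟨r, hr, fun θ t ht => ?_⟩
  have := (h 0 (by simpa)).2.2 θ t (by simpa using ht)
  simpa [shift_zero hx] using this

/-- A curve whose points are the images of one point under the flow is a trajectory. -/
lemma isTrajectory_of_flow [T2Space S] {γ : ℝ → S} {J : Set ℝ} {c : ℝ} {x : S}
    (h : ∀ u ∈ J, M.Flow θ (u - c) x (γ u)) : M.IsTrajectory θ γ J := by
  rw [isTrajectory_iff]
  intro s hs
  have hns := (h s hs).notMem_right
  refine ⟨hns, ?_⟩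
  obtain ⟨r, hr, hflow⟩ := exists_flow_shift hns
  have hnear : ∀ᶠ u in 𝓝[J] s, |u - s| < r :=
    eventually_nhdsWithin_of_eventually_nhds (eventually_abs_sub_lt s hr)
  filter_upwards [self_mem_nhdsWithin, hnear] with u hu hu'
  have h1 := (h s hs).add (hflow θ (u - s) hu')
  have h2 := h u hu
  rw [sub_add_sub_comm, add_comm s u, add_sub_add_right_eq_sub] at h1
  exact h2.unique h1

/-- The flow commutes with small translations. -/
lemma Flow.eventually_shift [T2Space S] {t : ℝ} {x y : S} (h : M.Flow θ t x y) :
    ∀ᶠ v in 𝓝 (0 : ℂ), M.Flow θ t (M.shift x v) (M.shift y v) := by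
  obtain ⟨γ, h, rfl, rfl⟩ := h
  -- The relation between two times is symmetric and transitive, so it only has to be checked for
  -- nearby times, inside one ball of translations.
  have key := isPreconnected_uIcc.induction₂ (s := uIcc 0 t)
    (fun a b => ∀ᶠ v in 𝓝 (0 : ℂ), M.Flow θ (b - a) (M.shift (γ a) v) (M.shift (γ b) v))
    (fun s hs => ?_) (fun a b c _ _ _ h1 h2 => ?_) (fun a b _ _ h => ?_) left_mem_uIcc
    right_mem_uIcc
  · simpa using key
  · obtain ⟨hns, hs'⟩ := isTrajectory_iff.1 h s hs
    obtain ⟨r, hr, hflow⟩ := exists_ball_flow_shift hns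
    have hnear : ∀ᶠ u in 𝓝[uIcc 0 t] s, ‖((u - s : ℝ) : ℂ) * (θ : ℂ)‖ < r / 2 := by
      have := (tendsto_sub_mul s (θ : ℂ) (uIcc 0 t)).norm
      rw [norm_zero] at this
      exact this.eventually (gt_mem_nhds (half_pos hr))
    filter_upwards [hs', hnear] with u hu hu'
    have h0 : ∀ᶠ v in 𝓝 (0 : ℂ), ‖v‖ < r / 2 :=
      tendsto_norm_zero.eventually_lt_const (half_pos hr)
    filter_upwards [h0, (hflow _ (hu'.trans (half_lt_self hr))).2.1] with v hv hv'
    rw [hu, hv', add_comm]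
    exact (hflow v (by linarith)).2.2 θ (u - s) ((norm_add_le _ _).trans_lt (by linarith))
  · filter_upwards [h1, h2] with v h1 h2
    have := h1.add h2
    rwa [add_comm, sub_add_sub_cancel] at this
  · filter_upwards [h] with v h
    simpa using h.symm

/-- If `ψ` is a trajectory of another directional flow, and `χ` is its image under the time-`t` map
of the flow, then `χ` is a trajectory as well. -/
lemma IsTrajectory.image_flow [T2Space S] {ν : Metric.sphere (0 : ℂ) 1} {ψ χ : ℝ → S} {J : Set ℝ}
    {t : ℝ} (hψ : M.IsTrajectory ν ψ J) (hχ : ∀ s ∈ J, M.Flow θ t (ψ s) (χ s)) :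
    M.IsTrajectory ν χ J := by
  rw [isTrajectory_iff] at hψ ⊢
  intro s hs
  refine ⟨(hχ s hs).notMem_right, ?_⟩
  filter_upwards [self_mem_nhdsWithin, (hψ s hs).2,
    (tendsto_sub_mul s (ν : ℂ) J).eventually (hχ s hs).eventually_shift] with u hu h1 h2
  have := hχ u hu
  rw [h1] at this
  exact this.unique h2

/-! ### Conical points -/

/-- `w` is a uniformizing coordinate of the conical point `P` of angle `2 (k + 1) π`. -/
def IsConeChart (M : TranslationSurface S) (P : S) (k : ℕ) (w : OpenPartialHomeomorph S ℂ) : Prop :=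
  P ∈ w.source ∧ w P = 0 ∧ w.source ∩ M.sing = {P} ∧
    ∀ e ∈ M.atlas, ∀ x ∈ e.source ∩ w.source,
      ∀ᶠ y in 𝓝 x, e y - w y ^ (k + 1) = e x - w x ^ (k + 1)

lemma exists_isConeChart {P : S} (hP : P ∈ M.sing) : ∃ k w, M.IsConeChart P k w := M.cone P hP

section Cone

variable {P : S} {k : ℕ} {w : OpenPartialHomeomorph S ℂ}

lemma IsConeChart.eq_of_mem_sing (hw : M.IsConeChart P k w) {x : S} (hx : x ∈ w.source)
    (hs : x ∈ M.sing) : x = P := by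
  have : x ∈ w.source ∩ M.sing := ⟨hx, hs⟩
  rwa [hw.2.2.1] at this

lemma IsConeChart.eq_of_apply_eq_zero (hw : M.IsConeChart P k w) {x : S} (hx : x ∈ w.source)
    (h : w x = 0) : x = P := w.injOn hx hw.1 (h.trans hw.2.1.symm)

lemma IsConeChart.symm_zero (hw : M.IsConeChart P k w) : w.symm 0 = P := by
  rw [← hw.2.1, w.left_inv hw.1]

lemma IsConeChart.exists_closedBall_subset (hw : M.IsConeChart P k w) :
    ∃ ρ > 0, Metric.closedBall (0 : ℂ) ρ ⊆ w.target := by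
  have h0 : (0 : ℂ) ∈ w.target := hw.2.1 ▸ w.map_source hw.1
  exact Metric.nhds_basis_closedBall.mem_iff.1 (w.open_target.mem_nhds h0)

lemma IsConeChart.eventually_norm_lt (hw : M.IsConeChart P k w) {ε : ℝ} (hε : 0 < ε) :
    ∀ᶠ x in 𝓝 P, x ∈ w.source ∧ ‖w x‖ < ε := by
  have h := (w.continuousAt hw.1).norm
  rw [ContinuousAt, hw.2.1, norm_zero] at h
  filter_upwards [w.open_source.mem_nhds hw.1, h.eventually_lt_const hε] with x h1 h2
    using ⟨h1, h2⟩

lemma IsConeChart.eventually_norm_pow_lt (hw : M.IsConeChart P k w) {ε : ℝ} (hε : 0 < ε) :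
    ∀ᶠ x in 𝓝 P, ‖w x ^ (k + 1)‖ < ε := by
  have h : Tendsto (fun x => ‖w x ^ (k + 1)‖) (𝓝 P) (𝓝 ‖w P ^ (k + 1)‖) :=
    ((w.continuousAt hw.1).tendsto.pow (k + 1)).norm
  rw [hw.2.1, zero_pow k.succ_ne_zero, norm_zero] at h
  exact h.eventually_lt_const hε

lemma IsTrajectory.eventually_cone (hw : M.IsConeChart P k w) {γ : ℝ → S} {J : Set ℝ}
    (h : M.IsTrajectory θ γ J) {s : ℝ} (hs : s ∈ J) (hsw : γ s ∈ w.source) :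
    ∀ᶠ u in 𝓝[J] s, γ u ∈ w.source ∧
      w (γ u) ^ (k + 1) = w (γ s) ^ (k + 1) + ((u - s : ℝ) : ℂ) * θ := by
  obtain ⟨hns, h'⟩ := isTrajectory_iff.1 h s hs
  have h1 := eventually_coord_shift hns (f := fun y => w y ^ (k + 1))
    fun e he hxe => hw.2.2.2 e he (γ s) ⟨hxe, hsw⟩
  filter_upwards [h', (tendsto_sub_mul s (θ : ℂ) J).eventually h1,
    (h.1 s hs) (w.open_source.mem_nhds hsw)] with u h1 h2 h3
  refine ⟨h3, ?_⟩
  rw [h1, h2]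

/-- Near a conical point that it approaches at time `a`, a trajectory is given by
`w ^ (k + 1) = (t - a) θ`. -/
lemma IsTrajectory.cone_eq (hw : M.IsConeChart P k w) {γ : ℝ → S} {J : Set ℝ}
    (h : M.IsTrajectory θ γ J) (hJ : IsPreconnected J) (hsw : ∀ s ∈ J, γ s ∈ w.source) {a : ℝ}
    [NeBot (𝓝[J] a)] (ha : Tendsto γ (𝓝[J] a) (𝓝 P)) {t : ℝ} (ht : t ∈ J) :
    w (γ t) ^ (k + 1) = ((t - a : ℝ) : ℂ) * θ := by
  have hconst : ∀ u ∈ J, w (γ u) ^ (k + 1) = w (γ t) ^ (k + 1) + ((u - t : ℝ) : ℂ) * θ := by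
    intro u hu
    refine hJ.induction₂
      (fun s u => w (γ u) ^ (k + 1) = w (γ s) ^ (k + 1) + ((u - s : ℝ) : ℂ) * θ)
      (fun s hs => ?_) (fun x y z _ _ _ h1 h2 => ?_) (fun x y _ _ h => ?_) ht hu
    · exact (h.eventually_cone hw hs (hsw s hs)).mono fun _ h => h.2
    · rw [h2, h1]; push_cast; ring
    · rw [h]; push_cast; ring
  have h1 : Tendsto (fun u => w (γ u) ^ (k + 1)) (𝓝[J] a) (𝓝 0) := by
    have := ((w.continuousAt hw.1).tendsto.comp ha).pow (k + 1)
    simpa [hw.2.1] using this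
  have h2 : Tendsto (fun u : ℝ => w (γ t) ^ (k + 1) + ((u - t : ℝ) : ℂ) * (θ : ℂ)) (𝓝[J] a)
      (𝓝 (w (γ t) ^ (k + 1) + ((a - t : ℝ) : ℂ) * θ)) := by
    have : Continuous fun u : ℝ => w (γ t) ^ (k + 1) + ((u - t : ℝ) : ℂ) * (θ : ℂ) := by fun_prop
    exact (this.tendsto a).mono_left nhdsWithin_le_nhds
  have h3 := tendsto_nhds_unique (h1.congr' (eventually_nhdsWithin_of_forall hconst)) h2
  push_cast at h3 ⊢
  linear_combination -h3

/-- A trajectory starting near a conical point stays in the domain of the uniformizing coordinate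
as long as its development does not leave a disc. -/
lemma Flow.confine [T2Space S] (hw : M.IsConeChart P k w) {ρ : ℝ}
    (hρ : Metric.closedBall (0 : ℂ) ρ ⊆ w.target) {t : ℝ} {x y : S} (h : M.Flow θ t x y)
    (hx : x ∈ w.source) (hxρ : ‖w x‖ < ρ)
    (hlt : ∀ u ∈ uIcc 0 t, ‖w x ^ (k + 1) + (u : ℂ) * θ‖ < ρ ^ (k + 1)) :
    y ∈ w.source ∧ w y ^ (k + 1) = w x ^ (k + 1) + (t : ℂ) * θ := by
  obtain ⟨γ, h, rfl, rfl⟩ := h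
  set Q : ℝ → Prop := fun u => γ u ∈ w.source ∧ ‖w (γ u)‖ < ρ ∧
    w (γ u) ^ (k + 1) = w (γ 0) ^ (k + 1) + (u : ℂ) * θ with hQ
  have h0 : Q 0 := ⟨hx, hxρ, by simp⟩
  have hρ0 : 0 ≤ ρ := (norm_nonneg _).trans hxρ.le
  suffices Q t from ⟨this.1, this.2.2⟩
  refine (isPreconnected_uIcc.induction₂ (s := uIcc 0 t) (fun a b => Q a ↔ Q b) (fun s hs => ?_)
    (fun _ _ _ _ _ _ => Iff.trans) (fun _ _ _ _ => Iff.symm) left_mem_uIcc right_mem_uIcc).1 h0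
  by_cases hQs : Q s
  · have hcont := ((w.continuousAt hQs.1).comp_continuousWithinAt (h.1 s hs)).norm
    filter_upwards [h.eventually_cone hw hs hQs.1, hcont.eventually_lt_const hQs.2.1] with u h1 h2
    refine iff_of_true hQs ⟨h1.1, h2, ?_⟩
    rw [h1.2, hQs.2.2]
    push_cast
    ring
  · suffices ∀ᶠ u in 𝓝[uIcc 0 t] s, ¬ Q u from this.mono fun u hu => iff_of_false hQs hu
    by_contra hfr
    rw [not_eventually] at hfr
    simp only [not_not] at hfr
    apply hQs
    -- Closedness of `Q`: the closed disc is compact in the surface, so a limit stays in the domain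
    -- of `w`; the strict bound on `‖w‖` is then recovered from `hlt`.
    have hK : IsCompact (w.symm '' Metric.closedBall (0 : ℂ) ρ) :=
      (isCompact_closedBall 0 ρ).image_of_continuousOn (w.continuousOn_symm.mono hρ)
    have hmem : γ s ∈ w.symm '' Metric.closedBall (0 : ℂ) ρ := by
      refine hK.isClosed.mem_of_frequently_of_tendsto (hfr.mono fun u hu => ?_) (h.1 s hs)
      exact ⟨w (γ u), by simpa using hu.2.1.le, w.left_inv hu.1⟩
    have hsrc : γ s ∈ w.source := by
      obtain ⟨z, hz, hz'⟩ := hmem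
      exact hz' ▸ w.map_target (hρ hz)
    have heq : w (γ s) ^ (k + 1) = w (γ 0) ^ (k + 1) + (s : ℂ) * θ := by
      have hc1 : ContinuousWithinAt (fun u => w (γ u) ^ (k + 1)) (uIcc 0 t) s :=
        ((w.continuousAt hsrc).comp_continuousWithinAt (h.1 s hs)).pow _
      have hc2 : ContinuousWithinAt (fun u : ℝ => w (γ 0) ^ (k + 1) + (u : ℂ) * (θ : ℂ))
          (uIcc 0 t) s := by fun_prop
      exact isClosed_diagonal.mem_of_frequently_of_tendsto
        (hfr.mono fun u hu => hu.2.2) (hc1.prodMk_nhds hc2)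
    refine ⟨hsrc, ?_, heq⟩
    have := hlt s hs
    rw [← heq, norm_pow] at this
    exact lt_of_pow_lt_pow_left₀ _ hρ0 this

end Cone

/-! ### Trajectories that reach a singularity -/

/-- The trajectory of `x` reaches the singularity `P` at the positive time `T`. -/
def Hits (M : TranslationSurface S) (θ : Metric.sphere (0 : ℂ) 1) (x : S) (T : ℝ) (P : S) : Prop :=
  0 < T ∧ P ∈ M.sing ∧ ∃ γ : ℝ → S, (∀ t ∈ Ico 0 T, M.Flow θ t x (γ t)) ∧
    Tendsto γ (𝓝[<] T) (𝓝 P)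

lemma exists_flow_of_le {x y : S} {t u : ℝ} (h : M.Flow θ t x y) (hu : 0 ≤ u) (hut : u ≤ t) :
    ∃ z, M.Flow θ u x z := by
  obtain ⟨z, hz, -⟩ := h.exists_between (u := u) (by rw [uIcc_of_le (hu.trans hut)]; exact ⟨hu, hut⟩)
  exact ⟨z, hz⟩

/-- A trajectory defined up to time `T` has a regular point as its limit at `T`, whereas the limit
is the singularity `P`. -/
lemma Hits.not_flow [T2Space S] {x P : S} {T : ℝ} (h : M.Hits θ x T P) {t : ℝ} (ht : T ≤ t) {y : S} :
    ¬ M.Flow θ t x y := by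
  intro hy
  obtain ⟨hT, hP, γ, hγ, hlim⟩ := h
  obtain ⟨z, hz⟩ := exists_flow_of_le hy hT.le ht
  obtain ⟨γ', h', rfl, rfl, hfl⟩ := hz.exists_trajectory
  rw [uIcc_of_le hT.le] at h' hfl
  have h1 : Tendsto γ' (𝓝[<] T) (𝓝 (γ' T)) := by
    have := h'.1 T (right_mem_Icc.2 hT.le)
    rw [ContinuousWithinAt] at this
    refine this.mono_left ?_
    rw [← nhdsWithin_Ico_eq_nhdsLT hT]
    exact nhdsWithin_mono _ Ico_subset_Icc_self
  have h2 : γ =ᶠ[𝓝[<] T] γ' := by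
    rw [← nhdsWithin_Ico_eq_nhdsLT hT]
    filter_upwards [self_mem_nhdsWithin] with u hu
    have h3 := hfl 0 (left_mem_Icc.2 hT.le) u (Ico_subset_Icc_self hu)
    rw [sub_zero] at h3
    exact (hγ u hu).unique h3
  have h3 := tendsto_nhds_unique (hlim.congr' h2) h1
  exact (h'.2 T (right_mem_Icc.2 hT.le)).1 (h3 ▸ hP)

/-- By compactness the trajectory clusters somewhere as time tends to `T`. Near a regular cluster
point it could be prolonged past `T`. At a conical cluster point its development converges, so the
cluster point is a limit. -/
lemma exists_hits [T2Space S] [CompactSpace S] {x : S} {T : ℝ} (hT : 0 < T)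
    (h : ∀ t ∈ Ico 0 T, ∃ y, M.Flow θ t x y) (hn : ¬ ∃ y, M.Flow θ T x y) :
    ∃ P, M.Hits θ x T P := by
  have h' : ∀ t, ∃ y, t ∈ Ico 0 T → M.Flow θ t x y := fun t => by
    by_cases ht : t ∈ Ico 0 T
    · obtain ⟨y, hy⟩ := h t ht
      exact ⟨y, fun _ => hy⟩
    · exact ⟨x, fun h => (ht h).elim⟩
  choose γ hγ using h'
  obtain ⟨q, hq⟩ := exists_clusterPt_of_compactSpace (map γ (𝓝[<] T))
  have hIco : ∀ᶠ t in 𝓝[<] T, t ∈ Ico 0 T := Ico_mem_nhdsLT hT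
  have hnear : ∀ ε > 0, ∀ᶠ t in 𝓝[<] T, T - t < ε := fun ε hε => by
    filter_upwards [Ioo_mem_nhdsLT (show T - ε < T by linarith)] with t ht
    linarith [ht.1]
  have hfreq : ∀ U ∈ 𝓝 q, ∃ᶠ t in 𝓝[<] T, γ t ∈ U := fun U hU =>
    mapClusterPt_iff_frequently.1 hq U hU
  by_cases hqs : q ∈ M.sing
  · refine ⟨q, hT, hqs, γ, hγ, ?_⟩
    obtain ⟨k, w, hw⟩ := exists_isConeChart hqs
    obtain ⟨ρ, hρ, hball⟩ := hw.exists_closedBall_subset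
    have hρk : 0 < ρ ^ (k + 1) / 2 := by positivity
    have hU : ∀ᶠ x in 𝓝 q, x ∈ w.source ∧ ‖w x‖ < ρ ∧ ‖w x ^ (k + 1)‖ < ρ ^ (k + 1) / 2 := by
      filter_upwards [hw.eventually_norm_lt hρ, hw.eventually_norm_pow_lt hρk] with x h1 h2
      exact ⟨h1.1, h1.2, h2⟩
    -- From `t₁` on, the starting value and the remaining time each contribute less than half of `ρ
    -- ^ (k + 1)`, so the rest of the trajectory is confined to the chart.
    obtain ⟨t₁, ⟨hs₁, hρ₁, hk₁⟩, ht₁, hn₁⟩ :=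
      ((hfreq _ hU).and_eventually (hIco.and (hnear _ hρk))).exists
    set c : ℂ := w (γ t₁) ^ (k + 1) + ((T - t₁ : ℝ) : ℂ) * θ with hc
    have key : ∀ᶠ t in 𝓝[<] T, γ t ∈ w.source ∧
        w (γ t) ^ (k + 1) = c + ((t - T : ℝ) : ℂ) * θ := by
      filter_upwards [Ico_mem_nhdsLT ht₁.2] with t ht
      have hfl := (hγ t₁ ht₁).symm.add (hγ t ⟨ht₁.1.trans ht.1, ht.2⟩)
      have h1 := hfl.confine hw hball hs₁ hρ₁ (fun u hu => by
        rw [uIcc_of_le (by linarith [ht.1])] at hu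
        refine (norm_add_le _ _).trans_lt ?_
        have : ‖(u : ℂ) * (θ : ℂ)‖ = u := by simp [abs_of_nonneg hu.1]
        rw [this]
        linarith [hu.2, ht.2])
      refine ⟨h1.1, ?_⟩
      rw [h1.2, hc]
      push_cast
      ring
    have hlim : Tendsto (fun t => w (γ t) ^ (k + 1)) (𝓝[<] T) (𝓝 c) := by
      have h1 : Tendsto (fun t : ℝ => c + ((t - T : ℝ) : ℂ) * (θ : ℂ)) (𝓝[<] T) (𝓝 (c + 0)) :=
        (tendsto_sub_mul T (θ : ℂ) (Iio T)).const_add c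
      rw [add_zero] at h1
      exact h1.congr' (key.mono fun t ht => ht.2.symm)
    have hc0 : c = 0 := by
      have h1 : MapClusterPt (w q ^ (k + 1)) (𝓝[<] T) (fun t => w (γ t) ^ (k + 1)) :=
        MapClusterPt.continuousAt_comp (f := fun x => w x ^ (k + 1))
          ((w.continuousAt hw.1).pow (k + 1)) hq
      have h2 : ClusterPt (w q ^ (k + 1)) (𝓝 c) := ClusterPt.mono h1 hlim
      have h3 := eq_of_nhds_neBot h2
      rw [← h3, hw.2.1]
      simp
    rw [hc0] at hlim
    have hw0 : Tendsto (fun t => w (γ t)) (𝓝[<] T) (𝓝 0) := by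
      rw [Metric.tendsto_nhds]
      intro ε hε
      have h1 := hlim.norm
      rw [norm_zero] at h1
      filter_upwards [h1.eventually_lt_const (pow_pos hε (k + 1))] with t ht
      rw [norm_pow] at ht
      simpa using lt_of_pow_lt_pow_left₀ _ hε.le ht
    have h0 : (0 : ℂ) ∈ w.target := hw.2.1 ▸ w.map_source hw.1
    have h1 := (w.symm.continuousAt h0).tendsto.comp hw0
    rw [hw.symm_zero] at h1
    exact h1.congr' (key.mono fun t ht => w.left_inv ht.1)
  · exfalso
    obtain ⟨r, hr, hflow⟩ := exists_ball_flow_shift hqs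
    have hU : M.shift q '' Metric.ball 0 (r / 2) ∈ 𝓝 q := by
      rw [← map_shift_nhds hqs]
      exact image_mem_map (Metric.ball_mem_nhds _ (half_pos hr))
    obtain ⟨t, ⟨v, hv, hvt⟩, ht, htr⟩ :=
      ((hfreq _ hU).and_eventually (hIco.and (hnear _ (half_pos hr)))).exists
    have hv' : ‖v‖ < r / 2 := by simpa using hv
    have h1 := (hflow v (by linarith)).2.2 θ (T - t) (by
      refine (norm_add_le _ _).trans_lt ?_
      have : ‖((T - t : ℝ) : ℂ) * (θ : ℂ)‖ = T - t := by
        rw [norm_mul, Complex.norm_real, norm_eq_of_mem_sphere, mul_one, Real.norm_eq_abs,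
          abs_of_nonneg (by linarith [ht.2])]
      rw [this]
      linarith)
    have h2 := (hγ t ht).add (hvt ▸ h1)
    rw [add_sub_cancel] at h2
    exact hn ⟨_, h2⟩

/-- Openness of the flow domain gives extra time locally, and compactness makes it uniform. Hence
the infimum of the times at which some point of `K` fails to flow is attained. -/
lemma IsCompact.exists_flow_add [T2Space S] {K : Set S} (hK : IsCompact K) {T : ℝ}
    (h : ∀ x ∈ K, ∃ y, M.Flow θ T x y) : ∃ η > 0, ∀ x ∈ K, ∀ t ∈ Icc T (T + η),
      ∃ y, M.Flow θ t x y := by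
  refine hK.induction_on (p := fun K => ∃ η > 0, ∀ x ∈ K, ∀ t ∈ Icc T (T + η),
    ∃ y, M.Flow θ t x y) ⟨1, one_pos, by simp⟩ ?_ ?_ ?_
  · rintro s t hst ⟨η, hη, h⟩
    exact ⟨η, hη, fun x hx => h x (hst hx)⟩
  · rintro s t ⟨η, hη, h⟩ ⟨η', hη', h'⟩
    refine ⟨min η η', lt_min hη hη', fun x hx t ht => ?_⟩
    rcases hx with hx | hx
    · exact h x hx t ⟨ht.1, ht.2.trans (by gcongr; exact min_le_left _ _)⟩
    · exact h' x hx t ⟨ht.1, ht.2.trans (by gcongr; exact min_le_right _ _)⟩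
  · intro x hx
    obtain ⟨y, hy⟩ := h x hx
    obtain ⟨r, hr, hflow⟩ := exists_ball_flow_shift hy.notMem_right
    have hev : ∀ᶠ x' in 𝓝 x, ∀ t ∈ Icc T (T + r / 3), ∃ y, M.Flow θ t x' y := by
      rw [eventually_nhds_iff_shift hy.notMem_left]
      filter_upwards [hy.eventually_shift,
        tendsto_norm_zero.eventually_lt_const (half_pos hr)] with v hv hv' t ht
      have h1 := (hflow v (by linarith)).2.2 θ (t - T) (by
        refine (norm_add_le _ _).trans_lt ?_
        have : ‖((t - T : ℝ) : ℂ) * (θ : ℂ)‖ = t - T := by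
          rw [norm_mul, Complex.norm_real, norm_eq_of_mem_sphere, mul_one, Real.norm_eq_abs,
            abs_of_nonneg (by linarith [ht.1])]
        rw [this]
        linarith [ht.2])
      have h2 := hv.add h1
      rw [add_sub_cancel] at h2
      exact ⟨_, h2⟩
    exact ⟨_, mem_nhdsWithin_of_mem_nhds hev, r / 3, by positivity, fun x' hx' => hx'⟩

/-- Either all points of a compact set of regular points can flow forever, or there is a first time
at which one of them reaches a singularity. -/
lemma forall_flow_or_exists_hits [T2Space S] [CompactSpace S] (θ : Metric.sphere (0 : ℂ) 1)
    {K : Set S} (hK : IsCompact K) (hKs : ∀ x ∈ K, x ∉ M.sing) :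
    (∀ x ∈ K, ∀ t, 0 ≤ t → ∃ y, M.Flow θ t x y) ∨
    ∃ T, (∀ x ∈ K, ∀ t ∈ Ico 0 T, ∃ y, M.Flow θ t x y) ∧ ∃ x ∈ K, ∃ P, M.Hits θ x T P := by
  by_cases hall : ∀ x ∈ K, ∀ t, 0 ≤ t → ∃ y, M.Flow θ t x y
  · exact Or.inl hall
  right
  set B : Set ℝ := {t | 0 ≤ t ∧ ∃ x ∈ K, ¬ ∃ y, M.Flow θ t x y} with hB
  have hne : B.Nonempty := by
    push Not at hall
    obtain ⟨x, hx, t, ht, h⟩ := hall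
    exact ⟨t, ht, x, hx, by simpa using h⟩
  have hbdd : BddBelow B := ⟨0, fun t ht => ht.1⟩
  have hlt : ∀ x ∈ K, ∀ t ∈ Ico 0 (sInf B), ∃ y, M.Flow θ t x y := by
    intro x hx t ht
    by_contra hcon
    exact (notMem_of_lt_csInf ht.2 hbdd) ⟨ht.1, x, hx, hcon⟩
  have hnot : ∃ x ∈ K, ¬ ∃ y, M.Flow θ (sInf B) x y := by
    by_contra! hcon
    obtain ⟨η, hη, h⟩ := IsCompact.exists_flow_add hK hcon
    have : sInf B + η ≤ sInf B := by
      refine le_csInf hne ?_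
      rintro t ⟨ht0, x, hx, hnx⟩
      by_contra! hlt'
      rcases lt_or_ge t (sInf B) with h1 | h1
      · exact hnx (hlt x hx t ⟨ht0, h1⟩)
      · exact hnx (h x hx t ⟨h1, hlt'.le⟩)
    linarith
  obtain ⟨x, hx, hnx⟩ := hnot
  have h0 : 0 ≤ sInf B := le_csInf hne fun t ht => ht.1
  have hpos : 0 < sInf B := by
    refine h0.lt_of_ne fun h => hnx ?_
    rw [← h]
    exact ⟨x, flow_zero (hKs x hx)⟩
  exact ⟨_, hlt, x, hx, exists_hits hpos (hlt x hx) hnx⟩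

lemma forall_flow_or_hits [T2Space S] [CompactSpace S] (θ : Metric.sphere (0 : ℂ) 1) {x : S}
    (hx : x ∉ M.sing) :
    (∀ t, 0 ≤ t → ∃ y, M.Flow θ t x y) ∨ ∃ T P, M.Hits θ x T P := by
  rcases forall_flow_or_exists_hits θ (isCompact_singleton (x := x)) (by simpa) with h | h
  · exact Or.inl (h x rfl)
  · obtain ⟨T, -, y, rfl, P, h⟩ := h
    exact Or.inr ⟨T, P, h⟩

/-- The two half-trajectories are glued at `x`, which sits at time `T'`. Thus, without saddle
connections, every regular point flows forever in at least one time direction. -/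
lemma Hits.hasSaddleConnection [T2Space S] {x P P' : S} {T T' : ℝ} (h : M.Hits θ x T P)
    (h' : M.Hits (-θ) x T' P') : M.HasSaddleConnection θ := by
  obtain ⟨hT, hP, γ₁, hγ₁, hlim₁⟩ := h
  obtain ⟨hT', hP', γ₂, hγ₂, hlim₂⟩ := h'
  have hT'' : 0 < T' + T := by linarith
  set γ : ℝ → S := fun u => if u ≤ 0 then P' else if T' + T ≤ u then P else
    if T' ≤ u then γ₁ (u - T') else γ₂ (T' - u) with hγ
  have hγ0 : γ 0 = P' := by simp [hγ]
  have hγL : γ (T' + T) = P := by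
    simp only [hγ, le_refl, if_true]
    rw [if_neg (by linarith)]
  have hfl : ∀ u ∈ Ioo 0 (T' + T), M.Flow θ (u - T') x (γ u) := by
    rintro u ⟨hu0, huL⟩
    simp only [hγ, if_neg hu0.not_ge, if_neg huL.not_ge]
    split_ifs with h
    · exact hγ₁ _ ⟨by linarith, by linarith⟩
    · have := flow_neg_iff.1 (hγ₂ (T' - u) ⟨by linarith, by linarith⟩)
      rwa [neg_sub] at this
  have htr := isTrajectory_of_flow hfl
  refine ⟨T' + T, γ, hT'', ?_, hγ0 ▸ hP', hγL ▸ hP, htr⟩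
  have hl : Tendsto γ (𝓝[>] 0) (𝓝 (γ 0)) := by
    rw [hγ0]
    have h1 : Tendsto (fun u : ℝ => T' - u) (𝓝[>] 0) (𝓝[<] T') := by
      refine tendsto_nhdsWithin_of_tendsto_nhds_of_eventually_within _ ?_ ?_
      · have : Continuous fun u : ℝ => T' - u := by fun_prop
        simpa using (this.tendsto 0).mono_left nhdsWithin_le_nhds
      · filter_upwards [self_mem_nhdsWithin] with u hu
        simpa using hu
    refine (hlim₂.comp h1).congr' ?_
    filter_upwards [Ioo_mem_nhdsGT hT'] with u hu
    simp only [hγ, Function.comp]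
    rw [if_neg (by linarith [hu.1]), if_neg (by linarith [hu.2]), if_neg (by linarith [hu.2])]
  have hr : Tendsto γ (𝓝[<] (T' + T)) (𝓝 (γ (T' + T))) := by
    rw [hγL]
    have h1 : Tendsto (fun u : ℝ => u - T') (𝓝[<] (T' + T)) (𝓝[<] T) := by
      refine tendsto_nhdsWithin_of_tendsto_nhds_of_eventually_within _ ?_ ?_
      · have : Continuous fun u : ℝ => u - T' := by fun_prop
        simpa using (this.tendsto (T' + T)).mono_left nhdsWithin_le_nhds
      · filter_upwards [self_mem_nhdsWithin] with u hu
        simp only [mem_Iio] at hu ⊢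
        linarith
    refine (hlim₁.comp h1).congr' ?_
    filter_upwards [Ioo_mem_nhdsLT (show T' < T' + T by linarith)] with u hu
    simp only [hγ, Function.comp]
    rw [if_neg (by linarith [hu.1]), if_neg (by linarith [hu.2]), if_pos hu.1.le]
  intro u hu
  rcases eq_endpoints_or_mem_Ioo_of_mem_Icc hu with rfl | rfl | hu'
  · exact (continuousWithinAt_Ioi_iff_Ici.1 hl).mono Icc_subset_Ici_self
  · exact (continuousWithinAt_Iio_iff_Iic.1 hr).mono Icc_subset_Iic_self
  · exact ((htr.1 u hu').continuousAt (Ioo_mem_nhds hu'.1 hu'.2)).continuousWithinAt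

/-- At time `r` before the singularity the position is a root of an equation of degree `k + 1` that
depends only on `r` and `θ`, which bounds the number of incoming separatrices. -/
lemma Hits.eventually_cone [T2Space S] {x P : S} {T : ℝ} (h : M.Hits θ x T P) {k : ℕ}
    {w : OpenPartialHomeomorph S ℂ} (hw : M.IsConeChart P k w) :
    ∀ᶠ r in 𝓝[>] (0 : ℝ), ∃ q, M.Flow θ (T - r) x q ∧ q ∈ w.source ∧
      w q ^ (k + 1) = (-r : ℂ) * θ := by
  obtain ⟨hT, hP, γ, hγ, hlim⟩ := h
  obtain ⟨a, ha, haw⟩ := (mem_nhdsLT_iff_exists_mem_Ico_Ioo_subset hT).1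
    (hlim.eventually (w.open_source.mem_nhds hw.1))
  have htr : M.IsTrajectory θ γ (Ioo a T) := isTrajectory_of_flow (c := 0) (x := x)
    fun u hu => by simpa using hγ u ⟨ha.1.trans hu.1.le, hu.2⟩
  have hE : 𝓝[Ioo a T] T = 𝓝[<] T := nhdsWithin_Ioo_eq_nhdsLT ha.2
  have : NeBot (𝓝[Ioo a T] T) := hE ▸ inferInstance
  filter_upwards [Ioo_mem_nhdsGT (show 0 < T - a by linarith [ha.2])] with r hr
  have hmem : T - r ∈ Ioo a T := ⟨by linarith [hr.2], by linarith [hr.1]⟩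
  refine ⟨γ (T - r), hγ _ ⟨ha.1.trans hmem.1.le, hmem.2⟩, haw hmem, ?_⟩
  rw [htr.cone_eq hw isPreconnected_Ioo (fun s hs => haw hs) (hE ▸ hlim) hmem]
  push_cast
  ring

/-- There are finitely many incoming separatrices: among infinitely many points that reach a
singularity, two lie on the same leaf. -/
lemma exists_flow_of_hits [T2Space S] {x P : ℕ → S} {T : ℕ → ℝ}
    (h : ∀ n, M.Hits θ (x n) (T n) (P n)) :
    ∃ n m, n < m ∧ M.Flow θ (T m - T n) (x m) (x n) := by
  have : Finite M.sing := M.sing_finite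
  obtain ⟨⟨Q, hQ⟩, hinf⟩ := Finite.exists_infinite_fiber (fun n => (⟨P n, (h n).2.1⟩ : M.sing))
  have hinf' : {n | P n = Q}.Infinite := by
    have := Set.infinite_coe_iff.1 hinf
    convert this using 1
    ext n
    simp
  obtain ⟨k, w, hw⟩ := exists_isConeChart hQ
  -- One point more than the `k + 1` possible roots, so that two separatrices coincide.
  obtain ⟨s, hs, hcard⟩ := hinf'.exists_subset_card_eq (k + 2)
  have hev : ∀ᶠ r in 𝓝[>] (0 : ℝ), ∀ n ∈ s, ∃ q, M.Flow θ (T n - r) (x n) q ∧ q ∈ w.source ∧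
      w q ^ (k + 1) = (-r : ℂ) * θ := by
    rw [Finset.eventually_all]
    intro n hn
    have h1 := h n
    rw [show P n = Q from hs hn] at h1
    exact h1.eventually_cone hw
  obtain ⟨r, hr⟩ := hev.exists
  have : Nonempty S := ⟨Q⟩
  choose! q hq using hr
  classical
  obtain ⟨n, hn, m, hm, hne, heq⟩ := Finset.exists_ne_map_eq_of_card_lt_of_maps_to
    (s := s) (t := (Polynomial.nthRoots (k + 1) ((-r : ℂ) * (θ : ℂ))).toFinset)
    (f := fun n => w (q n)) (by
      refine (Multiset.toFinset_card_le _).trans_lt ?_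
      refine (Polynomial.card_nthRoots _ _).trans_lt ?_
      omega) (fun n hn => by
      simp only [Finset.mem_coe, Multiset.mem_toFinset]
      exact (Polynomial.mem_nthRoots (Nat.succ_pos k)).2 (hq n hn).2.2)
  have hqq : q n = q m := w.injOn (hq n hn).2.1 (hq m hm).2.1 heq
  have h1 := (hq n hn).1
  have h2 := (hq m hm).1
  rw [hqq] at h1
  rcases lt_or_gt_of_ne hne with hlt | hlt
  · refine ⟨n, m, hlt, ?_⟩
    have := h2.add h1.symm
    rwa [neg_sub, sub_add_sub_cancel] at this
  · refine ⟨m, n, hlt, ?_⟩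
    have := h1.add h2.symm
    rwa [neg_sub, sub_add_sub_cancel] at this

/-! ### The complement of the singularities -/

lemma exists_openPartialHomeomorph (M : TranslationSurface S) (x : S) :
    ∃ w : OpenPartialHomeomorph S ℂ, x ∈ w.source := by
  by_cases hx : x ∈ M.sing
  · obtain ⟨k, w, hw⟩ := exists_isConeChart hx
    exact ⟨w, hw.1⟩
  · obtain ⟨e, -, he⟩ := M.cover x hx
    exact ⟨e, he⟩

lemma nhdsNE_neBot (M : TranslationSurface S) (x : S) : NeBot (𝓝[≠] x) := by
  obtain ⟨w, hw⟩ := M.exists_openPartialHomeomorph x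
  rw [neBot_iff]
  intro h
  have h1 : {x} ∈ 𝓝 x := by
    have := (isOpen_singleton_iff_punctured_nhds x).2 h
    exact this.mem_nhds rfl
  have h2 := w.image_mem_nhds hw h1
  rw [image_singleton] at h2
  have h3 : (𝓝[≠] (w x)) = ⊥ := by
    rw [← isOpen_singleton_iff_punctured_nhds]
    exact isOpen_singleton_iff_nhds_eq_pure _ |>.2 (le_antisymm (by simpa using h2) (pure_le_nhds _))
  exact (inferInstance : NeBot (𝓝[≠] (w x))).ne h3

lemma dense_compl_sing [T1Space S] (M : TranslationSurface S) : Dense M.singᶜ := by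
  have : ∀ x : S, NeBot (𝓝[≠] x) := M.nhdsNE_neBot
  simpa [compl_eq_univ_sdiff] using dense_univ.sdiff_finite M.sing_finite

/-- The complement of the singularities is connected: it has no proper nonempty clopen subset. -/
lemma eq_compl_sing_of_clopen [ConnectedSpace S] (M : TranslationSurface S) {C : Set S}
    (hC : IsOpen C) (hCs : C ⊆ M.singᶜ) (hcl : ∀ p ∉ M.sing, p ∈ closure C → p ∈ C)
    (hne : C.Nonempty) : C = M.singᶜ := by
  have hnb : ∀ x : S, NeBot (𝓝[≠] x) := M.nhdsNE_neBot
  set D : Set S := M.singᶜ ∩ (closure C)ᶜ with hD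
  have hDo : IsOpen D := M.isOpen_compl_sing.inter isClosed_closure.isOpen_compl
  have hCD : Disjoint C D := disjoint_left.2 fun x hx hx' => hx'.2 (subset_closure hx)
  have hcov : M.singᶜ ⊆ C ∪ D := fun x hx => by
    by_cases h : x ∈ closure C
    · exact Or.inl (hcl x hx h)
    · exact Or.inr ⟨hx, h⟩
  -- `E` adds to an open set the points that have a punctured neighbourhood in it. It turns a
  -- separation of `S ∖ Σ` into one of `S`, since small punctured discs around singularities are
  -- connected.
  set E : Set S → Set S := fun C => {x | ∀ᶠ y in 𝓝[≠] x, y ∈ C} with hE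
  have hsub : ∀ C : Set S, IsOpen C → C ⊆ E C := fun C hC x hx =>
    eventually_nhdsWithin_of_eventually_nhds (hC.mem_nhds hx)
  have hopen : ∀ C : Set S, IsOpen C → IsOpen (E C) := by
    intro C hC
    rw [isOpen_iff_mem_nhds]
    intro x hx
    have h1 : ∀ᶠ y in 𝓝 x, y ≠ x → y ∈ C := eventually_nhdsWithin_iff.1 hx
    filter_upwards [h1] with y hy
    by_cases hyx : y = x
    · exact hyx ▸ hx
    · exact hsub C hC (hy hyx)
  have hdisj : Disjoint (E C) (E D) := by
    rw [disjoint_left]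
    intro x hx hx'
    have h1 : ∀ᶠ y in 𝓝[≠] x, y ∈ C := hx
    have h2 : ∀ᶠ y in 𝓝[≠] x, y ∈ D := hx'
    obtain ⟨y, hy, hy'⟩ := (h1.and h2).exists
    exact disjoint_left.1 hCD hy hy'
  have hall : E C ∪ E D = univ := by
    refine eq_univ_of_forall fun x => ?_
    by_cases hx : x ∈ M.sing
    · obtain ⟨k, w, hw⟩ := exists_isConeChart hx
      obtain ⟨ρ, hρ, hball⟩ := hw.exists_closedBall_subset
      have hpre : IsPreconnected (Metric.ball (0 : ℂ) ρ \ {0}) := by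
        have h1 : IsPreconnected (Ioo (0 : ℝ) ρ ×ˢ (univ : Set ℝ)) :=
          isPreconnected_Ioo.prod isPreconnected_univ
        have h2 : Metric.ball (0 : ℂ) ρ \ {0} =
            (fun p : ℝ × ℝ => (p.1 : ℂ) * Complex.exp (p.2 * Complex.I)) ''
              (Ioo (0 : ℝ) ρ ×ˢ (univ : Set ℝ)) := by
          ext z
          constructor
          · rintro ⟨hz, hz0⟩
            refine ⟨(‖z‖, z.arg), ⟨⟨norm_pos_iff.2 hz0, by simpa using hz⟩, mem_univ _⟩, ?_⟩
            exact Complex.norm_mul_exp_arg_mul_I z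
          · rintro ⟨⟨a, b⟩, ⟨⟨ha, hb⟩, -⟩, rfl⟩
            simp only [Set.mem_sdiff, Metric.mem_ball, dist_zero_right, mem_singleton_iff, norm_mul,
              Complex.norm_real, Complex.norm_exp_ofReal_mul_I, mul_one, mul_eq_zero,
              Complex.exp_ne_zero, or_false, Complex.ofReal_eq_zero]
            exact ⟨by rwa [Real.norm_eq_abs, abs_of_pos ha], ha.ne'⟩
        rw [h2]
        exact h1.image _ (by fun_prop)
      have htar : Metric.ball (0 : ℂ) ρ \ {0} ⊆ w.target :=
        sdiff_subset.trans (Metric.ball_subset_closedBall.trans hball)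
      have himg : IsPreconnected (w.symm '' (Metric.ball (0 : ℂ) ρ \ {0})) :=
        hpre.image _ (w.continuousOn_symm.mono htar)
      have hns : w.symm '' (Metric.ball (0 : ℂ) ρ \ {0}) ⊆ C ∪ D := by
        rintro _ ⟨z, hz, rfl⟩
        refine hcov fun hs => hz.2 ?_
        have := hw.eq_of_mem_sing (w.map_target (htar hz)) hs
        rw [mem_singleton_iff, ← w.right_inv (htar hz), this, hw.2.1]
      have hnhds : ∀ᶠ y in 𝓝[≠] x, y ∈ w.symm '' (Metric.ball (0 : ℂ) ρ \ {0}) := by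
        rw [eventually_nhdsWithin_iff]
        filter_upwards [hw.eventually_norm_lt hρ] with y hy hyx
        refine ⟨w y, ⟨by simpa using hy.2, fun h0 => hyx (hw.eq_of_apply_eq_zero hy.1 h0)⟩,
          w.left_inv hy.1⟩
      rcases himg.subset_or_subset hC hDo hCD hns with h | h
      · exact Or.inl (hnhds.mono fun y hy => h hy)
      · exact Or.inr (hnhds.mono fun y hy => h hy)
    · rcases hcov hx with h | h
      · exact Or.inl (hsub C hC h)
      · exact Or.inr (hsub D hDo h)
  have hEC : IsClopen (E C) := by
    refine ⟨?_, hopen C hC⟩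
    rw [← isOpen_compl_iff]
    have : (E C)ᶜ = E D := (IsCompl.of_eq hdisj.eq_bot hall).compl_eq
    rw [this]
    exact hopen D hDo
  have huniv : E C = univ := hEC.eq_univ (hne.mono (hsub C hC))
  refine hCs.antisymm fun x hx => ?_
  rcases hcov hx with h | h
  · exact h
  · exact (disjoint_left.1 hdisj (huniv ▸ mem_univ x) (hsub D hDo h)).elim

/-! ### Periodic points -/

lemma Flow.nsmul [T2Space S] {τ : ℝ} {p : S} (h : M.Flow θ τ p p) (n : ℕ) :
    M.Flow θ (n * τ) p p := by
  induction n with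
  | zero => simpa using flow_zero h.notMem_left
  | succ n ih =>
    have := ih.add h
    convert this using 1
    push_cast
    ring

/-- If some leaf is periodic and there is no saddle connection, then all points are periodic, which
is impossible near a singularity. -/
lemma not_flow_self [T2Space S] [CompactSpace S] [ConnectedSpace S] (hne : M.sing.Nonempty)
    (hsad : ¬ M.HasSaddleConnection θ) {τ : ℝ} (hτ : 0 < τ) (p : S) : ¬ M.Flow θ τ p p := by
  intro hp
  set C : Set S := {p | M.Flow θ τ p p} with hC
  have hCs : C ⊆ M.singᶜ := fun p hp => Flow.notMem_left hp
  have hCo : IsOpen C := by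
    rw [isOpen_iff_mem_nhds]
    intro p hp
    exact (eventually_nhds_iff_shift (hCs hp)).2 (Flow.eventually_shift hp)
  -- By continuity, a limit of points of period `τ` returns to itself provided it flows for time
  -- `τ`. The direction is left free because a limit point may flow long enough only backward.
  have hret : ∀ (θ' : Metric.sphere (0 : ℂ) 1) (τ : ℝ), ∀ p ∉ M.sing,
      p ∈ closure {p | M.Flow θ' τ p p} → ∀ y, M.Flow θ' τ p y → y = p := by
    intro θ' τ p hps hpc y hy
    have hfr := (frequently_nhds_iff_shift hps).1 (mem_closure_iff_frequently.1 hpc)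
    have h1 : ∃ᶠ v in 𝓝 (0 : ℂ), (M.shift y v, M.shift p v) ∈ diagonal S :=
      (hfr.and_eventually hy.eventually_shift).mono fun v hv => hv.2.unique hv.1
    exact isClosed_diagonal.mem_of_frequently_of_tendsto h1
      ((tendsto_shift hy.notMem_right).prodMk_nhds (tendsto_shift hps))
  have hcl : ∀ p ∉ M.sing, p ∈ closure C → p ∈ C := by
    intro p hps hpc
    rcases forall_flow_or_hits θ hps with h | ⟨T, P, h⟩
    · obtain ⟨y, hy⟩ := h τ hτ.le
      have := hret θ τ p hps hpc y hy
      exact this ▸ hy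
    rcases forall_flow_or_hits (-θ) hps with h' | ⟨T', P', h'⟩
    · obtain ⟨y, hy⟩ := h' τ hτ.le
      have hC' : {p | M.Flow (-θ) τ p p} = C := by
        ext p
        simp only [hC, mem_ofPred_eq, flow_neg_iff]
        exact ⟨fun h => by simpa using h.symm, fun h => h.symm⟩
      have := hret (-θ) τ p hps (hC' ▸ hpc) y hy
      have h2 := (flow_neg_iff.1 (this ▸ hy)).symm
      rw [neg_neg] at h2
      exact this ▸ h2
    · exact (hsad (h.hasSaddleConnection h')).elim
  have hall := M.eq_compl_sing_of_clopen hCo hCs hcl ⟨p, hp⟩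
  obtain ⟨P, hP⟩ := hne
  obtain ⟨k, w, hw⟩ := exists_isConeChart hP
  obtain ⟨ρ, hρ, hball⟩ := hw.exists_closedBall_subset
  set r : ℝ := ρ ^ (k + 1) / 2 with hr
  have hrpos : 0 < r := by positivity
  have hrlt : r < ρ ^ (k + 1) := half_lt_self (by positivity)
  -- The point with coordinate `z` runs into `P` after time exactly `r`, within the disc of radius
  -- `ρ`.
  obtain ⟨z, hz⟩ := IsAlgClosed.exists_pow_nat_eq (-(r : ℂ) * (θ : ℂ)) k.succ_pos
  rw [Nat.succ_eq_add_one] at hz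
  have hzr : ‖z‖ ^ (k + 1) = r := by
    rw [← norm_pow, hz]
    simp [abs_of_pos hrpos]
  have hzρ : ‖z‖ < ρ := lt_of_pow_lt_pow_left₀ (k + 1) hρ.le (by rw [hzr]; exact hrlt)
  have hz0 : z ≠ 0 := by
    rintro rfl
    simp at hzr
    exact hrpos.ne hzr
  have hzt : z ∈ w.target := hball (by simpa using hzρ.le)
  have hqs : w.symm z ∈ w.source := w.map_target hzt
  have hwq : w (w.symm z) = z := w.right_inv hzt
  have hq : w.symm z ∈ C := by
    rw [hall]
    intro hs
    have := hw.eq_of_mem_sing hqs hs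
    rw [this, hw.2.1] at hwq
    exact hz0 hwq.symm
  -- Being periodic, the point flows for time `n * τ > r`, hence past the time at which it would be
  -- at `P`.
  obtain ⟨n, hn⟩ := exists_nat_gt (r / τ)
  obtain ⟨y, hy⟩ := exists_flow_of_le (Flow.nsmul hq n) hrpos.le ((div_lt_iff₀ hτ).1 hn).le
  have hcon := hy.confine hw hball hqs (by rwa [hwq]) (fun u hu => by
    rw [uIcc_of_le hrpos.le] at hu
    have : w (w.symm z) ^ (k + 1) + (u : ℂ) * θ = ((u - r : ℝ) : ℂ) * θ := by
      rw [hwq, hz]; push_cast; ring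
    rw [this, norm_mul, Complex.norm_real, norm_eq_of_mem_sphere, mul_one, Real.norm_eq_abs]
    exact (abs_le.2 ⟨by linarith [hu.1], by linarith [hu.2]⟩ : |u - r| ≤ r).trans_lt hrlt)
  rw [hwq, hz, neg_mul, neg_add_cancel] at hcon
  exact hy.notMem_right (hw.eq_of_apply_eq_zero hcon.1 (pow_eq_zero_iff k.succ_ne_zero |>.1 hcon.2) ▸ hP)

/-! ### Recurrence -/

/-- `ν` is orthogonal to `θ`. -/
def IsNormal (θ ν : Metric.sphere (0 : ℂ) 1) : Prop :=
  (ν : ℂ) = Complex.I * θ ∨ (ν : ℂ) = -(Complex.I * θ)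

lemma exists_isNormal_smul (θ : Metric.sphere (0 : ℂ) 1) {h : ℝ} : ∃ ν, IsNormal θ ν ∧
    (h : ℂ) * (Complex.I * θ) = (|h| : ℝ) * (ν : ℂ) := by
  have h1 : ‖Complex.I * (θ : ℂ)‖ = 1 := by simp
  rcases le_total 0 h with hh | hh
  · exact ⟨⟨Complex.I * θ, by simp⟩, Or.inl rfl, by rw [abs_of_nonneg hh]⟩
  · exact ⟨⟨-(Complex.I * θ), by simp⟩, Or.inr rfl, by rw [abs_of_nonpos hh]; push_cast; ring⟩

lemma IsNormal.exists_decomp {ν : Metric.sphere (0 : ℂ) 1} (hν : IsNormal θ ν) (z : ℂ) :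
    ∃ h v : ℝ, z = h * (ν : ℂ) + v * (θ : ℂ) ∧ |h| ≤ ‖z‖ ∧ |v| ≤ ‖z‖ := by
  set c : ℂ := z * (starRingEnd ℂ) θ with hc
  have hθ : (starRingEnd ℂ) (θ : ℂ) * θ = 1 := by
    rw [mul_comm, Complex.mul_conj, Complex.normSq_eq_norm_sq]
    simp
  have hcz : z = c * θ := by rw [hc, mul_assoc, hθ, mul_one]
  have hcn : ‖c‖ = ‖z‖ := by rw [hc]; simp
  have hre := Complex.abs_re_le_norm c
  have him := Complex.abs_im_le_norm c
  rw [hcn] at hre him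
  have hri := Complex.re_add_im c
  rcases hν with hν | hν
  · refine ⟨c.im, c.re, ?_, him, hre⟩
    rw [hν]
    linear_combination hcz - (θ : ℂ) * hri
  · refine ⟨-c.im, c.re, ?_, by rwa [abs_neg], hre⟩
    rw [hν]
    push_cast
    linear_combination hcz - (θ : ℂ) * hri

/-- If a transverse segment flows forever, then it comes back: either its origin is periodic, or it
flows to another point of the segment, or it is reached from such a point. -/
lemma exists_return_of_forall_flow [T2Space S] [CompactSpace S] {ν : Metric.sphere (0 : ℂ) 1}
    (hν : IsNormal θ ν) {y : S} {ψ : ℝ → S} {δ : ℝ} (hδ : 0 < δ)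
    (hψ : ∀ s ∈ Icc 0 δ, M.Flow ν s y (ψ s))
    (hfl : ∀ s ∈ Icc 0 δ, ∀ t, 0 ≤ t → ∃ x, M.Flow θ t (ψ s) x) :
    ∃ τ > 0, M.Flow θ τ y y ∨ ∃ s ∈ Ioc 0 δ, M.Flow θ τ y (ψ s) ∨ M.Flow θ τ (ψ s) y := by
  have h' : ∀ s t, ∃ x, s ∈ Icc 0 δ → 0 ≤ t → M.Flow θ t (ψ s) x := fun s t => by
    by_cases h : s ∈ Icc 0 δ ∧ 0 ≤ t
    · obtain ⟨x, hx⟩ := hfl s h.1 t h.2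
      exact ⟨x, fun _ _ => hx⟩
    · exact ⟨y, fun h1 h2 => (h ⟨h1, h2⟩).elim⟩
  choose X hX using h'
  have hψtr : M.IsTrajectory ν ψ (Icc 0 δ) :=
    isTrajectory_of_flow (c := 0) fun s hs => by simpa using hψ s hs
  have hψν : ∀ s ∈ Icc 0 δ, ∀ s' ∈ Icc 0 δ, M.Flow ν (s' - s) (ψ s) (ψ s') := fun s hs s' hs' =>
    hψtr.flow (ordConnected_Icc.uIcc_subset hs hs')
  have hXν : ∀ t, 0 ≤ t → ∀ s ∈ Icc 0 δ, ∀ s' ∈ Icc 0 δ, M.Flow ν (s' - s) (X s t) (X s' t) :=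
    fun t ht s hs s' hs' => (hψtr.image_flow (χ := fun s => X s t) fun s hs => hX s t hs ht).flow
      (ordConnected_Icc.uIcc_subset hs hs')
  have hXθ : ∀ s ∈ Icc 0 δ, ∀ t, 0 ≤ t → ∀ t', 0 ≤ t' → M.Flow θ (t' - t) (X s t) (X s t') :=
    fun s hs t ht t' ht' => by
      have := (hX s t hs ht).symm.add (hX s t' hs ht')
      rwa [neg_add_eq_sub] at this
  have h0 : (0 : ℝ) ∈ Icc 0 δ := ⟨le_rfl, hδ.le⟩
  have hψ0 : ψ 0 = y := (hψ 0 h0).unique (flow_zero (hψ 0 h0).notMem_left)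
  -- The midpoint leaves room on the segment for small normal displacements of either sign.
  have hmid : δ / 2 ∈ Icc 0 δ := ⟨by linarith, by linarith⟩
  obtain ⟨q, hq⟩ := exists_clusterPt_of_compactSpace (map (fun n : ℕ => X (δ / 2) n) atTop)
  have hfreq : ∀ U ∈ 𝓝 q, ∀ N : ℕ, ∃ n ≥ N, X (δ / 2) n ∈ U := fun U hU =>
    frequently_atTop.1 (mapClusterPt_iff_frequently.1 hq U hU)
  by_cases hqs : q ∈ M.sing
  · exfalso
    obtain ⟨k, w, hw⟩ := exists_isConeChart hqs
    obtain ⟨ρ, hρ, hball⟩ := hw.exists_closedBall_subset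
    -- The strip swept by the segment would contain the cone point: the displacement `-z` towards
    -- `q` splits into a slide `h` along the segment and a time change `v`. The three bounds keep
    -- the path in the disc, `δ / 2 + h` in the segment and `n + v` nonnegative.
    set κ : ℝ := min (ρ ^ (k + 1) / 3) (min (δ / 2) 1) with hκ
    have hκ0 : 0 < κ := by positivity
    have hκ1 : κ ≤ ρ ^ (k + 1) / 3 := min_le_left _ _
    have hκ2 : κ ≤ δ / 2 := (min_le_right _ _).trans (min_le_left _ _)
    have hκ3 : κ ≤ 1 := (min_le_right _ _).trans (min_le_right _ _)
    obtain ⟨n, hn, ⟨hsrc, hnρ⟩, hnκ⟩ := hfreq _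
      ((hw.eventually_norm_lt hρ).and (hw.eventually_norm_pow_lt hκ0)) 1
    have hn1 : (1 : ℝ) ≤ n := by exact_mod_cast hn
    set z : ℂ := w (X (δ / 2) n) ^ (k + 1) with hz
    obtain ⟨h, v, hzv, hh, hv⟩ := hν.exists_decomp (-z)
    rw [norm_neg] at hh hv
    have hh' := abs_le.1 hh
    have hv' := abs_le.1 hv
    have hhm : δ / 2 + h ∈ Icc 0 δ := ⟨by linarith, by linarith⟩
    have hun : ∀ {a u : ℝ}, u ∈ uIcc 0 a → |u| ≤ |a| := fun {a u} hu => by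
      simpa using abs_sub_left_of_mem_uIcc hu
    have f1 := hXν n (by linarith) _ hmid _ hhm
    rw [add_sub_cancel_left] at f1
    have c1 := f1.confine hw hball hsrc hnρ fun u hu => by
      refine (norm_add_le _ _).trans_lt ?_
      rw [norm_mul, Complex.norm_real, norm_eq_of_mem_sphere, mul_one, Real.norm_eq_abs]
      linarith [hun hu]
    rw [← hz] at c1
    have f2 := hXθ _ hhm n (by linarith) (n + v) (by linarith)
    rw [add_sub_cancel_left] at f2
    have c2 := f2.confine hw hball c1.1 (by
        refine lt_of_pow_lt_pow_left₀ (k + 1) hρ.le ?_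
        rw [← norm_pow, c1.2]
        refine (norm_add_le _ _).trans_lt ?_
        rw [norm_mul, Complex.norm_real, norm_eq_of_mem_sphere, mul_one, Real.norm_eq_abs]
        linarith) fun u hu => by
      rw [c1.2]
      refine (norm_add₃_le).trans_lt ?_
      rw [norm_mul, norm_mul, Complex.norm_real, Complex.norm_real, norm_eq_of_mem_sphere,
        norm_eq_of_mem_sphere, mul_one, mul_one, Real.norm_eq_abs, Real.norm_eq_abs]
      linarith [hun hu]
    rw [c1.2, add_assoc, ← hzv, add_neg_cancel] at c2
    exact f2.notMem_right
      (hw.eq_of_apply_eq_zero c2.1 (pow_eq_zero_iff k.succ_ne_zero |>.1 c2.2) ▸ hqs)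
  · obtain ⟨r, hr, hflow⟩ := exists_ball_flow_shift hqs
    -- Here `h` and `v` are smaller than `2 * κ`: the bounds keep the path in the ball, `δ / 2 + h`
    -- in the segment, and `v` below `m - n`, so that `τ > 0`.
    set κ : ℝ := min (r / 3) (min (δ / 4) (1 / 4)) with hκ
    have hκ0 : 0 < κ := by positivity
    have hκ1 : κ ≤ r / 3 := min_le_left _ _
    have hκ2 : κ ≤ δ / 4 := (min_le_right _ _).trans (min_le_left _ _)
    have hκ3 : κ ≤ 1 / 4 := (min_le_right _ _).trans (min_le_right _ _)
    have hU : M.shift q '' Metric.ball 0 κ ∈ 𝓝 q := by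
      rw [← map_shift_nhds hqs]
      exact image_mem_map (Metric.ball_mem_nhds _ hκ0)
    obtain ⟨n, -, a, ha, hna⟩ := hfreq _ hU 0
    obtain ⟨m, hm, b, hb, hmb⟩ := hfreq _ hU (n + 1)
    have hnm : (n : ℝ) + 1 ≤ m := by exact_mod_cast hm
    have hn0 : (0 : ℝ) ≤ n := n.cast_nonneg
    simp only [mem_ball_zero_iff] at ha hb
    obtain ⟨h, v, hhv, hh, hv⟩ := hν.exists_decomp (b - a)
    have hba : ‖b - a‖ < 2 * κ := (norm_sub_le _ _).trans_lt (by linarith)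
    have hh' := abs_le.1 hh
    have hv' := abs_le.1 hv
    have hhm : δ / 2 + h ∈ Icc 0 δ := ⟨by linarith, by linarith⟩
    have hahr : ‖a + h * (ν : ℂ)‖ < r := by
      refine (norm_add_le _ _).trans_lt ?_
      rw [norm_mul, Complex.norm_real, norm_eq_of_mem_sphere, mul_one, Real.norm_eq_abs]
      linarith
    have hb' : a + h * (ν : ℂ) + v * (θ : ℂ) = b := by linear_combination -hhv
    have f1 := (hflow a (by linarith)).2.2 ν h hahr
    have f2 := (hflow _ hahr).2.2 θ v (by rw [hb']; linarith)
    rw [hb', hmb] at f2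
    rw [hna] at f1
    have f3 := hXν n hn0 _ hmid _ hhm
    rw [add_sub_cancel_left] at f3
    rw [f1.unique f3] at f2
    set τ : ℝ := m - n - v with hτ
    have hτ0 : 0 < τ := by linarith
    have f4 : M.Flow θ τ (ψ (δ / 2)) (ψ (δ / 2 + h)) := by
      have := ((hX _ m hmid (by linarith)).add f2.symm).add (hX _ n hhm hn0).symm
      convert this using 1
      rw [hτ]
      ring
    have hXτ : X (δ / 2) τ = ψ (δ / 2 + h) := (hX _ τ hmid hτ0.le).unique f4
    -- The time-`τ` map sends parameter `δ / 2` to `δ / 2 + h` and commutes with sliding along the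
    -- segment. So it sends `-h` to `0` if `h < 0`, and `0` to `h` otherwise.
    rcases lt_or_ge h 0 with hneg | hpos
    · have hm1 : -h ∈ Icc 0 δ := ⟨by linarith, by linarith⟩
      have f5 := hXν τ hτ0.le _ hm1 _ hmid
      rw [hXτ, sub_neg_eq_add] at f5
      have f6 := hX _ τ hm1 hτ0.le
      rw [f5.unique_left (hψ _ hhm)] at f6
      exact ⟨τ, hτ0, Or.inr ⟨-h, ⟨by linarith, hm1.2⟩, Or.inr f6⟩⟩
    · have hm1 : h ∈ Icc 0 δ := ⟨hpos, by linarith⟩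
      have f5 := hXν τ hτ0.le _ h0 _ hmid
      have f7 := hψν _ hm1 _ hhm
      rw [hXτ, sub_zero] at f5
      rw [add_sub_cancel_right] at f7
      have f6 := hX _ τ h0 hτ0.le
      rw [f5.unique_left f7, hψ0] at f6
      rcases hpos.eq_or_lt with rfl | hpos'
      · rw [hψ0] at f6
        exact ⟨τ, hτ0, Or.inl f6⟩
      · exact ⟨τ, hτ0, Or.inr ⟨h, ⟨hpos', hm1.2⟩, Or.inl f6⟩⟩

/-- If arbitrarily short transverse segments with origin `y` contain points that reach a
singularity, whereas `y` flows forever, then `y` flows to another point of the segment. -/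
lemma exists_return_of_exists_hits [T2Space S] [CompactSpace S] {ν : Metric.sphere (0 : ℂ) 1}
    {y : S} {ψ : ℝ → S} {ε : ℝ} (hε : 0 < ε) (hψ : ∀ s ∈ Icc 0 ε, M.Flow ν s y (ψ s))
    (hy : ∀ t, 0 ≤ t → ∃ x, M.Flow θ t y x)
    (hhit : ∀ δ ∈ Ioc 0 ε, ¬ ∀ s ∈ Icc 0 δ, ∀ t, 0 ≤ t → ∃ x, M.Flow θ t (ψ s) x) :
    ∃ τ > 0, ∃ s ∈ Ioc 0 ε, M.Flow θ τ y (ψ s) := by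
  have hψtr : M.IsTrajectory ν ψ (Icc 0 ε) :=
    isTrajectory_of_flow (c := 0) fun s hs => by simpa using hψ s hs
  have h0 : (0 : ℝ) ∈ Icc 0 ε := ⟨le_rfl, hε.le⟩
  have hψ0 : ψ 0 = y := (hψ 0 h0).unique (flow_zero (hψ 0 h0).notMem_left)
  -- In a good triple `(s, T, P)`, no point of the segment up to `s` stops before time `T`, when the
  -- endpoint `ψ s` reaches `P`.
  set good : ℝ × ℝ × S → Prop := fun p => p.1 ∈ Ioc 0 ε ∧ M.Hits θ (ψ p.1) p.2.1 p.2.2 ∧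
    ∀ s ∈ Icc 0 p.1, ∀ t ∈ Ico 0 p.2.1, ∃ x, M.Flow θ t (ψ s) x with hgood
  have hex : ∀ δ ∈ Ioc 0 ε, ∃ p, good p ∧ p.1 ≤ δ := by
    intro δ hδ
    have hsub : Icc 0 δ ⊆ Icc 0 ε := Icc_subset_Icc_right hδ.2
    have hK : IsCompact (ψ '' Icc 0 δ) := isCompact_Icc.image_of_continuousOn (hψtr.1.mono hsub)
    rcases forall_flow_or_exists_hits θ hK (by
      rintro _ ⟨s, hs, rfl⟩
      exact (hψ s (hsub hs)).notMem_right) with h | ⟨T, hT, _, ⟨s, hs, rfl⟩, P, hP⟩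
    · exact (hhit δ hδ fun s hs => h _ (mem_image_of_mem _ hs)).elim
    · have hs0 : 0 < s := by
        refine hs.1.lt_of_ne ?_
        rintro rfl
        obtain ⟨x, hx⟩ := hy T hP.1.le
        exact hP.not_flow le_rfl (hψ0.symm ▸ hx)
      exact ⟨(s, T, P), ⟨⟨hs0, hs.2.trans hδ.2⟩, hP, fun s' hs' =>
        hT _ (mem_image_of_mem _ ⟨hs'.1, hs'.2.trans hs.2⟩)⟩, hs.2⟩
  -- As `y` flows beyond time `T`, so do all nearby points of the segment; a shorter segment
  -- therefore has a strictly later hitting time.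
  have hstep : ∀ p : {p // good p}, ∃ p' : {p // good p}, p'.1.1 < p.1.1 ∧ p.1.2.1 < p'.1.2.1 := by
    rintro ⟨⟨s, T, P⟩, hs, hT, -⟩
    obtain ⟨x, hx⟩ := hy T hT.1.le
    have hev : ∀ᶠ u in 𝓝[Icc 0 ε] 0, ∃ x', M.Flow θ T (ψ u) x' := by
      have h1 : ∀ᶠ x' in 𝓝 (ψ 0), ∃ z, M.Flow θ T x' z := by
        rw [hψ0, eventually_nhds_iff_shift hx.notMem_left]
        exact hx.eventually_shift.mono fun v hv => ⟨_, hv⟩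
      exact (hψtr.1 0 h0).eventually h1
    rw [nhdsWithin_Icc_eq_nhdsGE hε] at hev
    obtain ⟨δ, hδ, hδ'⟩ := (mem_nhdsGE_iff_exists_Ico_subset).1 hev
    have hδ0 : 0 < δ := hδ
    obtain ⟨p', hp', hle⟩ := hex (min (δ / 2) (s / 2))
      ⟨lt_min (by linarith) (by linarith [hs.1]), (min_le_right _ _).trans (by linarith [hs.1, hs.2])⟩
    refine ⟨⟨p', hp'⟩, ?_, ?_⟩
    · linarith [hle.trans (min_le_right _ _), hs.1]
    · obtain ⟨z, hz⟩ := hδ' ⟨hp'.1.1.le, by linarith [hle.trans (min_le_left _ _)]⟩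
      by_contra! hcon
      exact hp'.2.1.not_flow hcon hz
  choose g hg using hstep
  obtain ⟨p₀, hp₀, -⟩ := hex ε ⟨hε, le_rfl⟩
  set f : ℕ → {p // good p} := fun n => g^[n] ⟨p₀, hp₀⟩ with hf
  have hf' : ∀ n, f (n + 1) = g (f n) := fun n => Function.iterate_succ_apply' _ _ _
  have hs : StrictAnti fun n => (f n).1.1 := strictAnti_nat_of_succ_lt fun n => by
    rw [hf']; exact (hg _).1
  have hT : StrictMono fun n => (f n).1.2.1 := strictMono_nat_of_lt_succ fun n => by
    rw [hf']; exact (hg _).2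
  obtain ⟨n, m, hnm, hfl⟩ := exists_flow_of_hits fun n => (f n).2.2.1
  have hsm := (f m).2.1
  have hsn := (f n).2.1
  have hs' := hs hnm
  have hT' := hT hnm
  have hTn := (f n).2.2.1.1
  have hflow := (f m).2.2.2
  simp only at hs' hT'
  set a := (f m).1.1
  set b := (f n).1.1
  set τ := (f m).1.2.1 - (f n).1.2.1 with hτ
  have hτ0 : 0 < τ := by linarith
  -- Since `τ` is less than the hitting time for `a`, the whole segment up to `a` flows for time
  -- `τ`. Its endpoint `ψ a` lands on `ψ b`; sliding back by `a`, the origin lands on `ψ (b - a)`.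
  have h' : ∀ s, ∃ x, s ∈ Icc 0 a → M.Flow θ τ (ψ s) x := fun s => by
    by_cases h : s ∈ Icc 0 a
    · obtain ⟨x, hx⟩ := hflow s h τ ⟨hτ0.le, by linarith⟩
      exact ⟨x, fun _ => hx⟩
    · exact ⟨y, fun h1 => (h h1).elim⟩
  choose χ hχ using h'
  have ha : a ∈ Icc 0 a := ⟨hsm.1.le, le_rfl⟩
  have h0a : (0 : ℝ) ∈ Icc 0 a := ⟨le_rfl, hsm.1.le⟩
  have f1 : M.Flow ν (a - 0) (χ 0) (χ a) :=
    ((hψtr.mono (Icc_subset_Icc_right hsm.2)).image_flow hχ).flow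
      (ordConnected_Icc.uIcc_subset h0a ha)
  rw [(hχ a ha).unique hfl, sub_zero] at f1
  have f2 : M.Flow ν (b - (b - a)) (ψ (b - a)) (ψ b) :=
    hψtr.flow (ordConnected_Icc.uIcc_subset ⟨by linarith, by linarith [hsn.2, hsm.1]⟩
      ⟨hsn.1.le, hsn.2⟩)
  rw [sub_sub_cancel] at f2
  have f3 := hχ 0 h0a
  rw [f1.unique_left f2, hψ0] at f3
  exact ⟨τ, hτ0, b - a, ⟨by linarith, by linarith [hsn.2, hsm.1]⟩, f3⟩

/-- In the absence of periodic leaves, an invariant set cannot meet a transverse segment exactly in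
its origin when the origin flows forever. -/
lemma false_of_transversal [T2Space S] [CompactSpace S] {ν : Metric.sphere (0 : ℂ) 1}
    (hν : IsNormal θ ν) {y : S} {ψ : ℝ → S} {ε : ℝ} (hε : 0 < ε)
    (hψ : ∀ s ∈ Icc 0 ε, M.Flow ν s y (ψ s)) {A : Set S}
    (hA : ∀ x ∈ A, ∀ t x', M.Flow θ t x x' → x' ∈ A) (hyA : y ∈ A) (hψA : ∀ s ∈ Ioc 0 ε, ψ s ∉ A)
    (hper : ∀ τ > 0, ∀ p, ¬ M.Flow θ τ p p) (hy : ∀ t, 0 ≤ t → ∃ x, M.Flow θ t y x) : False := by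
  by_cases h : ∃ δ ∈ Ioc 0 ε, ∀ s ∈ Icc 0 δ, ∀ t, 0 ≤ t → ∃ x, M.Flow θ t (ψ s) x
  · obtain ⟨δ, hδ, h⟩ := h
    obtain ⟨τ, hτ, h | ⟨s, hs, h | h⟩⟩ := exists_return_of_forall_flow hν hδ.1
      (fun s hs => hψ s ⟨hs.1, hs.2.trans hδ.2⟩) h
    · exact hper τ hτ y h
    · exact hψA s ⟨hs.1, hs.2.trans hδ.2⟩ (hA y hyA _ _ h)
    · exact hψA s ⟨hs.1, hs.2.trans hδ.2⟩ (hA y hyA _ _ h.symm)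
  · push Not at h
    obtain ⟨τ, hτ, s, hs, h⟩ := exists_return_of_exists_hits hε hψ hy
      (fun δ hδ hall => by
        obtain ⟨s, hs, t, ht, hn⟩ := h δ hδ
        obtain ⟨x, hx⟩ := hall s hs t ht
        exact hn x hx)
    exact hψA s hs (hA y hyA _ _ h)

/-- A proper closed invariant set has an outer transverse segment at one of its points. -/
lemma exists_transversal [T2Space S] [ConnectedSpace S] {A : Set S} (hAc : IsClosed A)
    (hA : ∀ x ∈ A, ∀ t x', M.Flow θ t x x' → x' ∈ A) (hne : (A ∩ M.singᶜ).Nonempty)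
    (huniv : A ≠ univ) : ∃ ν, IsNormal θ ν ∧ ∃ y ∈ A, ∃ (ψ : ℝ → S) (ε : ℝ), 0 < ε ∧
      (∀ s ∈ Icc 0 ε, M.Flow ν s y (ψ s)) ∧ ∀ s ∈ Ioc 0 ε, ψ s ∉ A := by
  have hCne : (Aᶜ ∩ M.singᶜ).Nonempty :=
    M.dense_compl_sing.inter_open_nonempty _ hAc.isOpen_compl (nonempty_compl.2 huniv)
  -- Otherwise the complement of `A` would be open and closed in the connected set `S ∖ Σ`.
  obtain ⟨p, hps, hpc, hpA⟩ : ∃ p ∉ M.sing, p ∈ closure Aᶜ ∧ p ∈ A := by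
    by_contra! hcon
    have := M.eq_compl_sing_of_clopen (hAc.isOpen_compl.inter M.isOpen_compl_sing)
      inter_subset_right (fun p hp hpc => ⟨hcon p hp (closure_mono inter_subset_left hpc), hp⟩) hCne
    obtain ⟨x, hxA, hxs⟩ := hne
    have hx : x ∈ Aᶜ ∩ M.singᶜ := by rw [this]; exact hxs
    exact hx.1 hxA
  obtain ⟨r, hr, hflow⟩ := exists_ball_flow_shift hps
  have hfr := (frequently_nhds_iff_shift hps).1 (mem_closure_iff_frequently.1 hpc)
  obtain ⟨v, hvA, hvr⟩ := (hfr.and_eventually (tendsto_norm_zero.eventually_lt_const hr)).exists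
  obtain ⟨h, t, hv, hh, -⟩ :=
    (show IsNormal θ ⟨Complex.I * θ, by simp⟩ from Or.inl rfl).exists_decomp v
  obtain ⟨ν, hν, hνh⟩ := exists_isNormal_smul θ (h := h)
  simp only [hνh] at hv
  have hLr : ∀ u ∈ Icc 0 |h|, ‖(u : ℂ) * (ν : ℂ)‖ < r := fun u hu => by
    rw [norm_mul, Complex.norm_real, norm_eq_of_mem_sphere, mul_one, Real.norm_eq_abs,
      abs_of_nonneg hu.1]
    linarith [hu.2]
  have hLmem : |h| ∈ Icc 0 |h| := ⟨abs_nonneg h, le_rfl⟩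
  have h0mem : 0 ∈ Icc 0 |h| := ⟨le_rfl, abs_nonneg h⟩
  set φ : ℝ → S := fun u => M.shift p ((u : ℂ) * (ν : ℂ)) with hφ
  have hφ0 : φ 0 = p := by simp [hφ, shift_zero hps]
  have htr : M.IsTrajectory ν φ (Icc 0 |h|) := by
    refine isTrajectory_of_flow (c := 0) (x := p) fun u hu => ?_
    have := (hflow 0 (by simpa)).2.2 ν u (by simpa using hLr u hu)
    simpa [shift_zero hps] using this
  -- By invariance the component of `v` along `θ` is irrelevant to membership in `A`; the normal
  -- component alone already leaves `A`.
  have hLA : φ |h| ∉ A := fun hA' => by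
    refine hvA (hA _ hA' t _ ?_)
    have := (hflow _ (hLr _ hLmem)).2.2 θ t (by rwa [← hv])
    rwa [← hv] at this
  have hKc : IsCompact (Icc 0 |h| ∩ φ ⁻¹' A) := by
    refine isCompact_Icc.of_isClosed_subset ?_ inter_subset_left
    exact htr.1.preimage_isClosed_of_isClosed isClosed_Icc hAc
  -- `u₀` is the last parameter at which the normal segment meets `A`.
  obtain ⟨u₀, ⟨hu₀, hu₀A⟩, hmax⟩ := hKc.exists_isGreatest ⟨0, h0mem, by
    rw [mem_preimage, hφ0]; exact hpA⟩
  have hlt : u₀ < |h| := hu₀.2.lt_of_ne fun heq => hLA (heq ▸ hu₀A)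
  refine ⟨ν, hν, φ u₀, hu₀A, fun s => φ (u₀ + s), |h| - u₀, by linarith, fun s hs => ?_,
    fun s hs hsA => ?_⟩
  · have := htr.flow (a := u₀) (b := u₀ + s) (ordConnected_Icc.uIcc_subset hu₀
      ⟨by linarith [hu₀.1, hs.1], by linarith [hs.2]⟩)
    rwa [add_sub_cancel_left] at this
  · have := hmax ⟨⟨by linarith [hu₀.1, hs.1], by linarith [hs.2]⟩, hsA⟩
    linarith [hs.1]

/-! ### Minimality in the absence of saddle connections -/

lemma mem_leaf_self {x : S} (hx : x ∉ M.sing) : x ∈ M.leaf θ x := ⟨0, flow_zero hx⟩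

/-- Small translations commute with the flow, so leaf points near `y` are carried to leaf points
near `y'`. -/
lemma mem_closure_leaf_of_flow [T2Space S] {x y y' : S} {t : ℝ} (hy : y ∈ closure (M.leaf θ x))
    (h : M.Flow θ t y y') : y' ∈ closure (M.leaf θ x) := by
  rw [mem_closure_iff_frequently, frequently_nhds_iff_shift h.notMem_right]
  have := (frequently_nhds_iff_shift h.notMem_left).1 (mem_closure_iff_frequently.1 hy)
  refine (this.and_eventually h.eventually_shift).mono ?_
  rintro v ⟨⟨s, hs⟩, hv⟩
  exact ⟨s + t, hs.add hv⟩

theorem isMinimal_of_not_hasSaddleConnection [T2Space S] [CompactSpace S] [ConnectedSpace S]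
    (hne : M.sing.Nonempty) (hsad : ¬ M.HasSaddleConnection θ) : M.IsMinimal θ := by
  intro x hx
  by_contra hd
  set A : Set S := closure (M.leaf θ x) with hA
  have hinv : ∀ y ∈ A, ∀ t y', M.Flow θ t y y' → y' ∈ A := fun y hy t y' h =>
    mem_closure_leaf_of_flow hy h
  obtain ⟨ν, hν, y, hyA, ψ, ε, hε, hψ, hψA⟩ := exists_transversal isClosed_closure hinv
    ⟨x, subset_closure (mem_leaf_self hx), hx⟩ (fun h => hd (dense_iff_closure_eq.2 h))
  have hper : ∀ τ > 0, ∀ p, ¬ M.Flow θ τ p p := fun τ hτ p => not_flow_self hne hsad hτ p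
  have hys : y ∉ M.sing := (hψ 0 ⟨le_rfl, hε.le⟩).notMem_left
  rcases forall_flow_or_hits θ hys with h | ⟨T, P, h⟩
  · exact false_of_transversal hν hε hψ hinv hyA hψA hper h
  rcases forall_flow_or_hits (-θ) hys with h' | ⟨T', P', h'⟩
  -- The same transverse segment serves for the reversed flow: normality, invariance and absence of
  -- periodic points are symmetric under time reversal.
  · refine false_of_transversal (θ := -θ) ?_ hε hψ (fun z hz t z' hzz' => hinv z hz _ z'
      (flow_neg_iff.1 hzz')) hyA hψA (fun τ hτ p hp => hper τ hτ p ?_) h'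
    · have hcoe : ((-θ : Metric.sphere (0 : ℂ) 1) : ℂ) = -(θ : ℂ) := rfl
      rcases hν with hν | hν
      · exact Or.inr (by rw [hν, hcoe]; ring)
      · exact Or.inl (by rw [hν, hcoe]; ring)
    · simpa using (flow_neg_iff.1 hp).symm
  · exact hsad (h.hasSaddleConnection h')

/-! ### Saddle connections -/

lemma secondCountableTopology [CompactSpace S] (M : TranslationSurface S) :
    SecondCountableTopology S := by
  choose w hw using M.exists_openPartialHomeomorph
  obtain ⟨t, ht⟩ := CompactSpace.elim_nhds_subcover (fun x => (w x).source)
    fun x => (w x).open_source.mem_nhds (hw x)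
  have : ∀ x : t, SecondCountableTopology (w x).source := fun x =>
    (w x).secondCountableTopology_source
  refine TopologicalSpace.secondCountableTopology_of_countable_cover
    (fun x : t => (w x).open_source) ?_
  refine eq_univ_of_forall fun y => ?_
  obtain ⟨x, hx, hy⟩ := mem_iUnion₂.1 (ht.ge (mem_univ y))
  exact mem_iUnion.2 ⟨⟨x, hx⟩, hy⟩

/-- By the Lindelöf property, countably many neighbourhoods on which `f` is constant cover `V`. -/
lemma countable_image_of_locally_constant [SecondCountableTopology S] {f : S → ℂ} {V : Set S}
    (h : ∀ x ∈ V, ∀ᶠ y in 𝓝 x, f y = f x) : (f '' V).Countable := by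
  obtain ⟨t, htV, ht, hcov⟩ := TopologicalSpace.countable_cover_nhdsWithin
    (f := fun x => {y | f y = f x}) fun x hx => mem_nhdsWithin_of_mem_nhds (h x hx)
  refine (ht.image f).mono ?_
  rintro _ ⟨y, hy, rfl⟩
  obtain ⟨x, hx, hxy⟩ := mem_iUnion₂.1 (hcov hy)
  exact ⟨x, hx, Eq.symm hxy⟩

lemma countable_span_int {D : Set ℂ} (hD : D.Countable) :
    (Submodule.span ℤ D : Set ℂ).Countable := by
  have := hD.to_subtype
  rw [Finsupp.span_eq_range_linearCombination, LinearMap.coe_range]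
  exact countable_range _

lemma exists_countable_atlas [SecondCountableTopology S] (M : TranslationSurface S) :
    ∃ E ⊆ M.atlas, E.Countable ∧ ∀ x ∉ M.sing, ∃ e ∈ E, x ∈ e.source := by
  have hcov : ∀ x, ∃ e : OpenPartialHomeomorph S ℂ, x ∉ M.sing → e ∈ M.atlas ∧ x ∈ e.source := by
    intro x
    by_cases hx : x ∈ M.sing
    · exact (M.exists_openPartialHomeomorph x).imp fun e _ hns => (hns hx).elim
    · exact (M.cover x hx).imp fun e he _ => he
  choose e he using hcov
  obtain ⟨t, hts, ht, hcov⟩ := TopologicalSpace.countable_cover_nhdsWithin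
    (f := fun x => (e x).source) (s := M.singᶜ) fun x hx =>
      mem_nhdsWithin_of_mem_nhds ((e x).open_source.mem_nhds (he x hx).2)
  refine ⟨e '' t, ?_, ht.image e, fun x hx => ?_⟩
  · rintro _ ⟨x, hx, rfl⟩
    exact (he x (hts hx)).1
  · obtain ⟨y, hy, hxy⟩ := mem_iUnion₂.1 (hcov hx)
    exact ⟨e y, mem_image_of_mem _ hy, hxy⟩

/-- The holonomy vectors of the saddle connections lie in a countable group. -/
lemma exists_countable_holonomy [T2Space S] [CompactSpace S] (M : TranslationSurface S) :
    ∃ G : Set ℂ, G.Countable ∧ ∀ θ, M.HasSaddleConnection θ → ∃ L : ℝ, 0 < L ∧ (L : ℂ) * θ ∈ G := by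
  have := M.secondCountableTopology
  obtain ⟨E, hEM, hEc, hEcov⟩ := M.exists_countable_atlas
  have hcone : ∀ P : M.sing, ∃ k w, M.IsConeChart P k w := fun P => exists_isConeChart P.2
  choose k w hw using hcone
  -- All constants by which charts differ from one another and from the developments `w ^ (k + 1)`
  -- at the cone points.
  set D : Set ℂ := (⋃ e ∈ E, ⋃ e' ∈ E, (fun x => e' x - e x) '' (e.source ∩ e'.source)) ∪
    ⋃ e ∈ E, ⋃ P : M.sing, (fun x => e x - w P x ^ (k P + 1)) '' (e.source ∩ (w P).source) with hD
  have hDc : D.Countable := by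
    refine (hEc.biUnion fun e he => hEc.biUnion fun e' he' => ?_).union
      (hEc.biUnion fun e he => ?_)
    · exact countable_image_of_locally_constant fun x hx =>
        M.transition e (hEM he) e' (hEM he') x hx
    · have : Countable M.sing := M.sing_finite.countable.to_subtype
      exact countable_iUnion fun P => countable_image_of_locally_constant fun x hx =>
        (hw P).2.2.2 e (hEM he) x hx
  set G : Submodule ℤ ℂ := Submodule.span ℤ D with hG
  have hee : ∀ e ∈ E, ∀ e' ∈ E, ∀ x ∈ e.source, x ∈ e'.source → e' x - e x ∈ G :=
    fun e he e' he' x hx hx' => Submodule.subset_span (Or.inl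
      (mem_biUnion he (mem_biUnion he' ⟨x, ⟨hx, hx'⟩, rfl⟩)))
  have hew : ∀ e ∈ E, ∀ P : M.sing, ∀ x ∈ e.source, x ∈ (w P).source →
      e x - w P x ^ (k P + 1) ∈ G := fun e he P x hx hx' => Submodule.subset_span (Or.inr
      (mem_biUnion he (mem_iUnion.2 ⟨P, x, ⟨hx, hx'⟩, rfl⟩)))
  refine ⟨G, countable_span_int hDc, fun θ hθ => ?_⟩
  obtain ⟨L, γ, hL, hcont, h0, h1, htr⟩ := hθ
  refine ⟨L, hL, ?_⟩
  -- Modulo `G` the coordinate does not depend on the chart, and along the trajectory it grows as `t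
  -- * θ`; hence `Q` is locally constant in time.
  set Q : ℝ → Prop := fun t => ∀ e ∈ E, γ t ∈ e.source → e (γ t) - (t : ℂ) * θ ∈ G with hQ
  have hQiff : ∀ t, ∀ e ∈ E, γ t ∈ e.source → (Q t ↔ e (γ t) - (t : ℂ) * θ ∈ G) := by
    intro t e he hte
    refine ⟨fun h => h e he hte, fun h e' he' hte' => ?_⟩
    have := G.add_mem (hee e he e' he' _ hte hte') h
    rwa [sub_add_sub_cancel] at this
  have hQQ : ∀ s ∈ Ioo 0 L, ∀ u ∈ Ioo 0 L, (Q s ↔ Q u) := fun s hs u hu => by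
    refine isPreconnected_Ioo.induction₂ (fun a b => Q a ↔ Q b) (fun s hs => ?_)
      (fun _ _ _ _ _ _ => Iff.trans) (fun _ _ _ _ => Iff.symm) hs hu
    obtain ⟨hns, hloc⟩ := htr.2 s hs
    obtain ⟨e, he, hse⟩ := hEcov _ hns
    filter_upwards [hloc e (hEM he) hse, (htr.1 s hs) (e.open_source.mem_nhds hse)] with u hu hue
    rw [hQiff s e he hse, hQiff u e he hue, hu]
    have : e (γ s) + ((u - s : ℝ) : ℂ) * (θ : ℂ) - (u : ℂ) * θ = e (γ s) - (s : ℂ) * θ := by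
      push_cast; ring
    rw [this]
  obtain ⟨t₀, ht₀, hw₀, heq₀⟩ : ∃ t ∈ Ioo 0 L, γ t ∈ (w ⟨γ 0, h0⟩).source ∧
      w ⟨γ 0, h0⟩ (γ t) ^ (k ⟨γ 0, h0⟩ + 1) = ((t - 0 : ℝ) : ℂ) * θ := by
    have hlim : Tendsto γ (𝓝[>] 0) (𝓝 (γ 0)) := by
      rw [← nhdsWithin_Ioo_eq_nhdsGT hL]
      exact (hcont 0 (left_mem_Icc.2 hL.le)).mono_left (nhdsWithin_mono _ Ioo_subset_Icc_self)
    obtain ⟨a, ha, haw⟩ := (mem_nhdsGT_iff_exists_mem_Ioc_Ioo_subset hL).1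
      (hlim.eventually ((w ⟨γ 0, h0⟩).open_source.mem_nhds (hw ⟨γ 0, h0⟩).1))
    have hE : 𝓝[Ioo 0 a] 0 = 𝓝[>] (0 : ℝ) := nhdsWithin_Ioo_eq_nhdsGT ha.1
    have : NeBot (𝓝[Ioo 0 a] (0 : ℝ)) := hE ▸ inferInstance
    have hmem : a / 2 ∈ Ioo 0 a := ⟨half_pos ha.1, half_lt_self ha.1⟩
    exact ⟨a / 2, ⟨hmem.1, hmem.2.trans_le ha.2⟩, haw hmem,
      (htr.mono (Ioo_subset_Ioo_right ha.2)).cone_eq (hw ⟨γ 0, h0⟩) isPreconnected_Ioo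
        (fun s hs => haw hs) (hE ▸ hlim) hmem⟩
  obtain ⟨t₁, ht₁, hw₁, heq₁⟩ : ∃ t ∈ Ioo 0 L, γ t ∈ (w ⟨γ L, h1⟩).source ∧
      w ⟨γ L, h1⟩ (γ t) ^ (k ⟨γ L, h1⟩ + 1) = ((t - L : ℝ) : ℂ) * θ := by
    have hlim : Tendsto γ (𝓝[<] L) (𝓝 (γ L)) := by
      rw [← nhdsWithin_Ioo_eq_nhdsLT hL]
      exact (hcont L (right_mem_Icc.2 hL.le)).mono_left (nhdsWithin_mono _ Ioo_subset_Icc_self)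
    obtain ⟨a, ha, haw⟩ := (mem_nhdsLT_iff_exists_mem_Ico_Ioo_subset hL).1
      (hlim.eventually ((w ⟨γ L, h1⟩).open_source.mem_nhds (hw ⟨γ L, h1⟩).1))
    have hE : 𝓝[Ioo a L] L = 𝓝[<] L := nhdsWithin_Ioo_eq_nhdsLT ha.2
    have : NeBot (𝓝[Ioo a L] L) := hE ▸ inferInstance
    have hmem : (a + L) / 2 ∈ Ioo a L := ⟨by linarith [ha.2], by linarith [ha.2]⟩
    exact ⟨(a + L) / 2, ⟨ha.1.trans_lt hmem.1, hmem.2⟩, haw hmem,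
      (htr.mono (Ioo_subset_Ioo_left ha.1)).cone_eq (hw ⟨γ L, h1⟩) isPreconnected_Ioo
        (fun s hs => haw hs) (hE ▸ hlim) hmem⟩
  have hQ₀ : Q t₀ := by
    intro e he hte
    have := hew e he ⟨γ 0, h0⟩ _ hte hw₀
    rwa [heq₀, sub_zero] at this
  have hQ₁ : Q t₁ := (hQQ _ ht₀ _ ht₁).1 hQ₀
  obtain ⟨e, he, hte⟩ := hEcov _ (htr.2 t₁ ht₁).1
  -- The development is `t * θ` when measured from the initial singularity and `(t - L) * θ` from
  -- the final one; modulo `G` they agree, so `L * θ` lies in `G`.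
  have hmem := G.sub_mem (hew e he ⟨γ L, h1⟩ _ hte hw₁) (hQ₁ e he hte)
  rw [heq₁] at hmem
  have heq : e (γ t₁) - ((t₁ - L : ℝ) : ℂ) * (θ : ℂ) - (e (γ t₁) - (t₁ : ℂ) * θ) = (L : ℂ) * θ := by
    push_cast; ring
  rwa [heq] at hmem

theorem countable_hasSaddleConnection [T2Space S] [CompactSpace S] (M : TranslationSurface S) :
    {θ | M.HasSaddleConnection θ}.Countable := by
  obtain ⟨G, hG, h⟩ := M.exists_countable_holonomy
  have hsub : {θ | M.HasSaddleConnection θ} ⊆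
      ⋃ g ∈ G, {θ : Metric.sphere (0 : ℂ) 1 | ∃ L : ℝ, 0 < L ∧ (L : ℂ) * θ = g} := by
    intro θ hθ
    obtain ⟨L, hL, hmem⟩ := h θ hθ
    exact mem_biUnion hmem ⟨L, hL, rfl⟩
  refine (hG.biUnion fun g _ => Set.Subsingleton.countable ?_).mono hsub
  have hnorm : ∀ (L : ℝ) (θ : Metric.sphere (0 : ℂ) 1), 0 < L → (L : ℂ) * θ = g → L = ‖g‖ := by
    rintro L θ hL rfl
    simp [abs_of_pos hL]
  rintro θ ⟨L, hL, hg⟩ θ' ⟨L', hL', hg'⟩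
  have hLL : L = L' := (hnorm L θ hL hg).trans (hnorm L' θ' hL' hg').symm
  subst hLL
  have hL0 : (L : ℂ) ≠ 0 := by exact_mod_cast hL.ne'
  exact Subtype.ext (mul_left_cancel₀ hL0 (hg.trans hg'.symm))

/-! ### Surfaces without singularities -/

/-- A translation surface without singularities, with one marked point. -/
noncomputable def markPoint [T1Space S] (M : TranslationSurface S) (hM : M.sing = ∅) (p : S) :
    TranslationSurface S where
  sing := {p}
  sing_finite := finite_singleton p
  atlas := (fun e => e.restrOpen {p}ᶜ isOpen_compl_singleton) '' M.atlas
  source_subset := by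
    rintro _ ⟨e, he, rfl⟩
    exact inter_subset_right
  cover := by
    intro x hx
    obtain ⟨e, he, hxe⟩ := M.cover x (by simp [hM])
    exact ⟨_, mem_image_of_mem _ he, hxe, hx⟩
  transition := by
    rintro _ ⟨e, he, rfl⟩ _ ⟨e', he', rfl⟩ x ⟨hx, hx'⟩
    exact M.transition e he e' he' x ⟨hx.1, hx'.1⟩
  cone := by
    rintro P rfl
    obtain ⟨e, he, hPe⟩ := M.cover P (by simp [hM])
    -- A marked point has `k = 0`: the uniformizing coordinate is a chart translated to vanish at
    -- `P`.
    refine ⟨0, e.transHomeomorph (Homeomorph.addRight (-(e P))), hPe, by simp, ?_, ?_⟩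
    · exact inter_eq_right.2 (singleton_subset_iff.2 hPe)
    · rintro _ ⟨e', he', rfl⟩ x ⟨hx, hx'⟩
      filter_upwards [M.transition e he e' he' x ⟨hx', hx.1⟩] with y hy
      simp only [OpenPartialHomeomorph.coe_restrOpen, OpenPartialHomeomorph.transHomeomorph_apply,
        Function.comp_apply, Homeomorph.coe_addRight, zero_add, pow_one]
      linear_combination hy

lemma leaf_markPoint_subset [T1Space S] (hM : M.sing = ∅) (p x : S) :
    (M.markPoint hM p).leaf θ x ⊆ M.leaf θ x := by
  rintro y ⟨t, γ, ⟨hc, h⟩, h0, h1⟩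
  refine ⟨t, γ, ⟨hc, fun s hs => ⟨by simp [hM], fun e he hse => ?_⟩⟩, h0, h1⟩
  exact (h s hs).2 (e.restrOpen {p}ᶜ isOpen_compl_singleton) ⟨e, he, rfl⟩ ⟨hse, (h s hs).1⟩

/-- Marking `p` only cuts leaves, so density passes to the leaves of all other points. The leaf of
`p` contains the leaf of a nearby point different from `p`. -/
lemma isMinimal_of_isMinimal_markPoint [T2Space S] (hM : M.sing = ∅) (p : S)
    (h : (M.markPoint hM p).IsMinimal θ) : M.IsMinimal θ := by
  have hne : ∀ x ≠ p, Dense (M.leaf θ x) := fun x hx =>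
    (h x hx).mono (leaf_markPoint_subset hM p x)
  intro x hx
  by_cases hxp : x = p
  · obtain ⟨r, hr, hflow⟩ := exists_flow_shift hx
    have hinj : ∃ t y, M.Flow θ t x y ∧ y ≠ p := by
      obtain ⟨e, he, hxe⟩ := M.cover x hx
      have hlim : Tendsto (fun t : ℝ => (t : ℂ) * (θ : ℂ)) (𝓝[>] 0) (𝓝 0) := by
        simpa using tendsto_sub_mul 0 (θ : ℂ) (Ioi 0)
      obtain ⟨t, ht, ht0, htr⟩ :=
        ((hlim.eventually (eventually_chart_shift he hxe)).and (Ioo_mem_nhdsGT hr)).exists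
      refine ⟨t, _, hflow θ t (by rwa [abs_of_pos ht0]), fun heq => ?_⟩
      have h1 := ht.2
      rw [heq, hxp, left_eq_add] at h1
      rcases mul_eq_zero.1 h1 with h1 | h1
      · exact ht0.ne' (by exact_mod_cast h1)
      · have h2 := norm_eq_of_mem_sphere θ
        rw [h1, norm_zero] at h2
        exact zero_ne_one h2
    obtain ⟨t, y, hy, hyp⟩ := hinj
    refine (hne y hyp).mono ?_
    rintro z ⟨s, hs⟩
    exact ⟨t + s, hy.add hs⟩
  · exact hne x hxp

theorem countable_not_isMinimal [T2Space S] [CompactSpace S] [ConnectedSpace S]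
    (M : TranslationSurface S) : {θ | ¬ M.IsMinimal θ}.Countable := by
  rcases M.sing.eq_empty_or_nonempty with hM | hM
  · obtain ⟨p⟩ : Nonempty S := inferInstance
    refine (M.markPoint hM p).countable_hasSaddleConnection.mono fun θ hθ => ?_
    by_contra hsad
    exact hθ (isMinimal_of_isMinimal_markPoint hM p
      (isMinimal_of_not_hasSaddleConnection (singleton_nonempty p) hsad))
  · refine M.countable_hasSaddleConnection.mono fun θ hθ => ?_
    by_contra hsad
    exact hθ (isMinimal_of_not_hasSaddleConnection hM hsad)

end TranslationSurface

/-! ### Negligible sets of directions and the main theorem -/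

open scoped Pointwise in
/-- Countable sets of directions are negligible. -/
lemma toSphere_eq_zero_of_countable {s : Set (Metric.sphere (0 : ℂ) 1)} (hs : s.Countable) :
    (volume : Measure ℂ).toSphere s = 0 := by
  rw [Measure.toSphere_apply' _ hs.measurableSet]
  refine mul_eq_zero_of_right _ ?_
  -- The cone over `s` lies in countably many real lines, each of area zero.
  have hsub : Ioo (0 : ℝ) 1 • (Subtype.val '' s) ⊆
      ⋃ θ ∈ s, (Submodule.span ℝ {(θ : ℂ)} : Set ℂ) := by
    rintro _ ⟨r, -, _, ⟨θ, hθ, rfl⟩, rfl⟩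
    exact mem_biUnion hθ (Submodule.smul_mem _ _ (Submodule.mem_span_singleton_self _))
  refine measure_mono_null hsub ((measure_biUnion_null_iff hs).2 fun θ _ => ?_)
  refine Measure.addHaar_submodule _ _ fun htop => ?_
  have h1 := finrank_span_le_card (R := ℝ) ({(θ : ℂ)} : Set ℂ)
  rw [htop, finrank_top, Complex.finrank_real_complex] at h1
  simp at h1

theorem mainTheorem4 {S : Type*} [TopologicalSpace S] [CompactSpace S] [ConnectedSpace S]
    [T2Space S] (M : TranslationSurface S) :
    (∀ᵐ θ ∂((volume : Measure ℂ).toSphere), M.IsMinimal θ) ∧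
    {θ | ¬ M.IsMinimal θ}.Countable ∧
    (M.sing.Nonempty → ∀ θ, ¬ M.HasSaddleConnection θ → M.IsMinimal θ) ∧
    {θ | M.HasSaddleConnection θ}.Countable :=
  ⟨toSphere_eq_zero_of_countable M.countable_not_isMinimal, M.countable_not_isMinimal,
    fun hne _ hsad => TranslationSurface.isMinimal_of_not_hasSaddleConnection hne hsad,
    M.countable_hasSaddleConnection⟩
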